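/- All trees below are finite, rooted, ordered binary trees: the root has degree $1$ (so there is a root edge), and every vertex that is neither the root nor a leaf has degree $3$, with a left and a right child. Write $A\,B$ for the tree with left subtree $A$ and right subtree $B$. The vertices of the $1$-skeleton of the $d$-dimensional associahedron $A_d$ are the trees with $d+2$ leaves; two such trees are joined by an edge if one is obtained from the other by a single rotation, that is, by replacing the subtree $(A\,B)\,C$ below some vertex by $A\,(B\,C)$ and keeping the rest of the tree. A color vector of length $n$ is a tuple $\mathbf c=(c_1,\dots,c_n)$ of elements of $\mathbf Z_2\times\mathbf Z_2$. For a tree $T$ with $n$ leaves it determines a unique coloring of the edges of $T$ (including the root edge) by elements of $\mathbf Z_2\times\mathbf Z_2$ in which the edge at the $i$-th leaf from the left has color $c_i$ and the colors of the three edges at each vertex of degree $3$ sum to $0$. The vector $\mathbf c$ is valid for $T$ if this coloring is a proper edge $3$-coloring, i.e. it uses only the three nonzero colors and the three edges at each vertex of degree $3$ have different colors. The vector $\mathbf c$ is acceptable if it is valid for at least one tree with $n$ leaves. For $n=d+2$, the color graph of $\mathbf c$ is the subgraph of the $1$-skeleton of $A_d$ induced on the trees for which $\mathbf c$ is valid.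 **Theorem.** Let $d\ge 0$ and let $\mathbf c$ be an acceptable color vector of length $d+2$. Then the color graph of $\mathbf c$ in $A_d$ is either connected or has no edges. -/

import Mathlib

namespace ColoredTree

/-- Finite, rooted, locally ordered binary trees. `BinaryTree.nil` is the trivial tree (a root `*`
of degree one joined by the root edge to a single leaf), and `node () L R` is the tree with left
subtree `L` and right subtree `R`. -/
abbrev Tree := BinaryTree Unit

/-- The group of colors. -/
abbrev Color := ZMod 2 × ZMod 2

/-- Addresses of the vertices other than the root `*`: words in `0` (`false`, go to the left child)
and `1` (`true`, go to the right child). Every edge is named by the address of its lower end,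
so the root edge is named by the empty word. -/
abbrev Address := List Bool

/-- The addresses of the leaves, in left-right order. -/
def leaves : Tree → List Address
  | .nil => [[]]
  | .node _ L R => (leaves L).map (List.cons false) ++ (leaves R).map (List.cons true)

/-- The addresses of the internal vertices (those of degree three). -/
def internals : Tree → List Address
  | .nil => []
  | .node _ L R =>
      [] :: ((internals L).map (List.cons false) ++ (internals R).map (List.cons true))

/-- The edges of `T` (root edge, internal edges and leaf edges), each named by its lower end. -/
def edges (T : Tree) : Set Address := {u | u ∈ leaves T ∨ u ∈ internals T}

/-- `κ` is a coloring of the edges of `T` that gives the leaf edges the colors listed in `c`, from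
left to right, and for which the colors of the three edges at each vertex of degree three sum to
zero. Only the values of `κ` on `edges T` matter; the equation forces `T` to have as many leaves as
`c` has entries. -/
structure IsDetermined {n : ℕ} (T : Tree) (c : Fin n → Color) (κ : Address → Color) : Prop where
  leaf : (leaves T).map κ = List.ofFn c
  sum_eq_zero : ∀ u ∈ internals T, κ u + κ (u ++ [false]) + κ (u ++ [true]) = 0

theorem exists_coloring (T : Tree) : ∀ l : List Color, l.length = T.numLeaves →
    ∃ κ : Address → Color, (leaves T).map κ = l ∧
      ∀ u ∈ internals T, κ u + κ (u ++ [false]) + κ (u ++ [true]) = 0 := by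
  induction T with
  | nil =>
    intro l hl
    obtain ⟨a, rfl⟩ := List.length_eq_one_iff.1 hl
    exact ⟨fun _ => a, by simp [leaves], by simp [internals]⟩
  | node a L R hL hR =>
    intro l hl
    simp only [BinaryTree.numLeaves] at hl
    obtain ⟨κ₀, h₀, s₀⟩ := hL (l.take L.numLeaves) (by simp; omega)
    obtain ⟨κ₁, h₁, s₁⟩ := hR (l.drop L.numLeaves) (by simp; omega)
    let κ : Address → Color := fun u => match u with
      | [] => -(κ₀ [] + κ₁ [])
      | false :: v => κ₀ v
      | true :: v => κ₁ v
    refine ⟨κ, ?_, ?_⟩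
    · have e₀ : κ ∘ List.cons false = κ₀ := rfl
      have e₁ : κ ∘ List.cons true = κ₁ := rfl
      simp [leaves, e₀, e₁, h₀, h₁]
    · intro u hu
      simp only [internals, List.mem_cons, List.mem_append, List.mem_map] at hu
      rcases hu with rfl | ⟨v, hv, rfl⟩ | ⟨v, hv, rfl⟩
      · show -(κ₀ [] + κ₁ []) + κ₀ [] + κ₁ [] = 0
        abel
      · exact s₀ v hv
      · exact s₁ v hv

theorem coloring_unique (T : Tree) : ∀ κ κ' : Address → Color,
    (leaves T).map κ = (leaves T).map κ' →
    (∀ u ∈ internals T, κ u + κ (u ++ [false]) + κ (u ++ [true]) = 0) →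
    (∀ u ∈ internals T, κ' u + κ' (u ++ [false]) + κ' (u ++ [true]) = 0) →
    κ [] = κ' [] ∧ Set.EqOn κ κ' (edges T) := by
  induction T with
  | nil =>
    intro κ κ' h _ _
    have h' : κ [] = κ' [] := by simpa [leaves] using h
    exact ⟨h', fun u hu => by simp_all [edges, leaves, internals]⟩
  | node a L R hL hR =>
    intro κ κ' h s s'
    simp only [leaves, List.map_append, List.map_map] at h
    obtain ⟨h₀, h₁⟩ := List.append_inj h (by simp)
    obtain ⟨r₀, q₀⟩ := hL (κ ∘ List.cons false) (κ' ∘ List.cons false) h₀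
      (fun u hu => s _ (by simp [internals, hu])) (fun u hu => s' _ (by simp [internals, hu]))
    obtain ⟨r₁, q₁⟩ := hR (κ ∘ List.cons true) (κ' ∘ List.cons true) h₁
      (fun u hu => s _ (by simp [internals, hu])) (fun u hu => s' _ (by simp [internals, hu]))
    have t := s [] (by simp [internals])
    have t' := s' [] (by simp [internals])
    simp only [List.nil_append] at t t'
    simp only [Function.comp_apply] at r₀ r₁
    have r : κ [] = κ' [] := by
      rw [r₀, r₁, ← t'] at t
      exact add_right_cancel (add_right_cancel t)
    refine ⟨r, fun u hu => ?_⟩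
    simp only [edges, leaves, internals, Set.mem_ofPred_eq, List.mem_cons, List.mem_append,
      List.mem_map] at hu
    rcases hu with (⟨v, hv, rfl⟩ | ⟨v, hv, rfl⟩) | rfl | ⟨v, hv, rfl⟩ | ⟨v, hv, rfl⟩
    · exact q₀ (Or.inl hv)
    · exact q₁ (Or.inl hv)
    · exact r
    · exact q₀ (Or.inr hv)
    · exact q₁ (Or.inr hv)

/-- A color vector determines an edge coloring of every tree with the right number of leaves, and
that coloring is unique on the edges of the tree. -/
theorem exists_unique_isDetermined {n : ℕ} (T : Tree) (hT : T.numLeaves = n) (c : Fin n → Color) :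
    ∃ κ : Address → Color, IsDetermined T c κ ∧
      ∀ κ' : Address → Color, IsDetermined T c κ' → Set.EqOn κ κ' (edges T) := by
  obtain ⟨κ, h, s⟩ := exists_coloring T (List.ofFn c) (by simp [hT])
  exact ⟨κ, ⟨h, s⟩, fun κ' h' =>
    (coloring_unique T κ κ' (h.trans h'.leaf.symm) s h'.sum_eq_zero).2⟩

/-- `κ` is a proper edge 3-coloring of `T`: it uses only the three nonzero colors, and the three
edges at each vertex of degree three have different colors. -/
structure IsProper (T : Tree) (κ : Address → Color) : Prop where
  ne_zero : ∀ e ∈ edges T, κ e ≠ 0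
  distinct : ∀ u ∈ internals T,
    κ u ≠ κ (u ++ [false]) ∧ κ u ≠ κ (u ++ [true]) ∧ κ (u ++ [false]) ≠ κ (u ++ [true])

/-- The color vector `c` is valid for `T`: the edge coloring it determines (which is unique on the
edges of `T`) is a proper edge 3-coloring. -/
def Valid {n : ℕ} (T : Tree) (c : Fin n → Color) : Prop :=
  ∃ κ : Address → Color, IsDetermined T c κ ∧ IsProper T κ

/-- A color vector is acceptable if it is valid for some finite binary tree. -/
def Acceptable {n : ℕ} (c : Fin n → Color) : Prop := ∃ T : Tree, Valid T c

/-- `Rotates T S`: `S` arises from `T` by a rotation at some vertex `u`, that is, the subtree at `u`,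
of the form `(A B) C`, is replaced by `A (B C)`, and the rest of the tree is kept. -/
inductive Rotates : Tree → Tree → Prop
  | pivot (A B C : Tree) :
      Rotates (.node () (.node () A B) C) (.node () A (.node () B C))
  | left {L L' : Tree} (R : Tree) (h : Rotates L L') : Rotates (.node () L R) (.node () L' R)
  | right (L : Tree) {R R' : Tree} (h : Rotates R R') : Rotates (.node () L R) (.node () L R')

/-- The 1-skeleton of the associahedron `A_d`: its vertices are the binary trees with `d + 2`
leaves, and its edges join two trees that differ by one rotation. -/
def associahedron (d : ℕ) : SimpleGraph {T : Tree // T.numLeaves = d + 2} :=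
  SimpleGraph.fromRel fun T S => Rotates T.1 S.1

/-- The color graph of `c`: the subgraph of the 1-skeleton of `A_d` spanned by the trees for which
`c` is valid. -/
def colorGraph {d : ℕ} (c : Fin (d + 2) → Color) :
    SimpleGraph {T : {T : Tree // T.numLeaves = d + 2} | Valid T.1 c} :=
  (associahedron d).induce {T | Valid T.1 c}

end ColoredTree

/-! Every vertex of a properly colored tree sees the three colors in one of two cyclic orders. A
rotation from `(A B) C` to `A (B C)` keeps the coloring proper exactly when `A` and `C` have the
same color, that is, when the two vertices involved have the same order. So a tree is isolated in
the color graph exactly when adjacent vertices always have opposite orders.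

In such a tree the order at one vertex determines all others, and the states (color and order) of
consecutive leaves satisfy a local relation, `Follows`, in which the shape of the tree no longer
appears. Conversely, a chain of states for this relation forces every valid tree to be isolated
(`RigidFor.exists_chain`, `ValidFor.rigidFor_of_isChain`). Isolation is therefore a property `Rigid`
of the color vector alone: a rigid vector has a color graph without edges, and for any other vector
every valid tree has a neighbor.

For a vector that is not rigid, connectedness follows by induction on its length
(`allConn_of_not_rigid`). With at least four leaves, each tree can be moved to one in which two
sibling leaves can be contracted while a valid rotation survives (`HasEdge.exists_reducible`). The
contracted word is again not rigid, so by induction all trees with that sibling pair are connected.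
It remains to link the classes of two such pairs (`exists_link`). Disjoint pairs occur together in
one tree, by the existence criterion `exists_validFor`. Pairs overlapping in `x, y, x` are linked by
one rotation. Pairs overlapping in `x, y, x + y` are linked by two rotations next to a block of
color `y`, or through a third class if a neighboring letter is `y`; failure of rigidity is what
supplies the block (`rigid_of_forall_sum_ne`). -/

namespace ColoredTree

/-- The word `w` lists the leaf colors of a proper coloring of `T` (in which every edge has as
color the sum of the leaf colors below it). -/
def ValidFor : Tree → List Color → Prop
  | .nil, w => ∃ a, a ≠ 0 ∧ w = [a]
  | .node _ L R, w => ∃ u v, w = u ++ v ∧ ValidFor L u ∧ ValidFor R v ∧ u.sum ≠ v.sum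

/-! ### Basic properties of recursive validity -/

theorem validFor_node {a : Unit} {L R : Tree} {u v : List Color} (hL : ValidFor L u)
    (hR : ValidFor R v) (h : u.sum ≠ v.sum) : ValidFor (.node a L R) (u ++ v) :=
  ⟨u, v, rfl, hL, hR, h⟩

theorem validFor_nil {a : Color} (h : a ≠ 0) : ValidFor .nil [a] := ⟨a, h, rfl⟩

theorem ValidFor.length_eq {T : Tree} {w : List Color} (h : ValidFor T w) :
    w.length = T.numLeaves := by
  induction T generalizing w with
  | nil => obtain ⟨a, -, rfl⟩ := h; rfl
  | node _ L R hL hR =>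
    obtain ⟨u, v, rfl, h₁, h₂, -⟩ := h
    simp [BinaryTree.numLeaves, hL h₁, hR h₂]

theorem ValidFor.node_inv {a : Unit} {L R : Tree} {u v : List Color}
    (h : ValidFor (.node a L R) (u ++ v)) (hu : u.length = L.numLeaves) :
    ValidFor L u ∧ ValidFor R v ∧ u.sum ≠ v.sum := by
  obtain ⟨u', v', e, h₁, h₂, h₃⟩ := h
  obtain ⟨rfl, rfl⟩ := List.append_inj e (hu.trans h₁.length_eq.symm)
  exact ⟨h₁, h₂, h₃⟩

theorem add_ne_zero_iff_ne (a b : Color) : a + b ≠ 0 ↔ a ≠ b := by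
  revert a b; decide

theorem ValidFor.sum_ne_zero {T : Tree} {w : List Color} (h : ValidFor T w) : w.sum ≠ 0 := by
  cases T with
  | nil => obtain ⟨a, ha, rfl⟩ := h; simpa using ha
  | node _ L R =>
    obtain ⟨u, v, rfl, -, -, h⟩ := h
    rw [List.sum_append]
    exact (add_ne_zero_iff_ne _ _).2 h

theorem ValidFor.ne_zero_of_mem {T : Tree} {w : List Color} (h : ValidFor T w) {c : Color}
    (hc : c ∈ w) : c ≠ 0 := by
  induction T generalizing w with
  | nil => obtain ⟨a, ha, rfl⟩ := h; simp_all
  | node _ L R hL hR =>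
    obtain ⟨u, v, rfl, h₁, h₂, -⟩ := h
    rcases List.mem_append.1 hc with hc | hc
    · exact hL h₁ hc
    · exact hR h₂ hc

theorem Rotates.numLeaves_eq {T S : Tree} (h : Rotates T S) : T.numLeaves = S.numLeaves := by
  induction h with
  | pivot => simp [BinaryTree.numLeaves, add_assoc]
  | left R _ ih => simp [BinaryTree.numLeaves, ih]
  | right L _ ih => simp [BinaryTree.numLeaves, ih]

/-! ### Validity as a property of words -/

theorem sum_leaves_eq (κ : Address → Color) (T : Tree)
    (hs : ∀ u ∈ internals T, κ u + κ (u ++ [false]) + κ (u ++ [true]) = 0) :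
    κ [] = ((leaves T).map κ).sum := by
  induction T generalizing κ with
  | nil => simp [leaves]
  | node _ L R hL hR =>
    have h₀ := hL (κ ∘ List.cons false) (fun u hu => hs _ (by simp [internals, hu]))
    have h₁ := hR (κ ∘ List.cons true) (fun u hu => hs _ (by simp [internals, hu]))
    have t := hs [] (by simp [internals])
    simp only [leaves, List.map_append, List.map_map, List.sum_append, ← h₀, ← h₁]
    simp only [Function.comp_apply]
    simp only [List.nil_append] at t
    generalize κ [] = a at t ⊢
    generalize κ [false] = b at t ⊢
    generalize κ [true] = c at t ⊢
    revert a b c; decide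

/-- The root color is carried along so that the induction can compare the colors of the two subtrees
at their parent; it follows from the vertex equations by `sum_leaves_eq`. -/
theorem exists_proper_iff (T : Tree) (w : List Color) :
    (∃ κ : Address → Color, (leaves T).map κ = w ∧
      (∀ u ∈ internals T, κ u + κ (u ++ [false]) + κ (u ++ [true]) = 0) ∧ IsProper T κ ∧
      κ [] = w.sum) ↔ ValidFor T w := by
  induction T generalizing w with
  | nil =>
    constructor
    · rintro ⟨κ, rfl, -, h, -⟩
      exact ⟨κ [], h.ne_zero _ (by simp [edges, leaves]), by simp [leaves]⟩
    · rintro ⟨a, ha, rfl⟩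
      exact ⟨fun _ => a, by simp [leaves], by simp [internals],
        ⟨fun _ _ => ha, by simp [internals]⟩, by simp⟩
  | node _ L R hL hR =>
    constructor
    · rintro ⟨κ, rfl, hs, h, -⟩
      have s₀ : ∀ u ∈ internals L, (κ ∘ List.cons false) u + (κ ∘ List.cons false) (u ++ [false]) +
          (κ ∘ List.cons false) (u ++ [true]) = 0 := fun u hu => hs _ (by simp [internals, hu])
      have s₁ : ∀ u ∈ internals R, (κ ∘ List.cons true) u + (κ ∘ List.cons true) (u ++ [false]) +
          (κ ∘ List.cons true) (u ++ [true]) = 0 := fun u hu => hs _ (by simp [internals, hu])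
      refine ⟨_, _, by simp only [leaves, List.map_append, List.map_map],
        (hL _).1 ⟨κ ∘ List.cons false, rfl, s₀, ⟨?_, ?_⟩, sum_leaves_eq _ _ s₀⟩,
        (hR _).1 ⟨κ ∘ List.cons true, rfl, s₁, ⟨?_, ?_⟩, sum_leaves_eq _ _ s₁⟩, ?_⟩
      · intro e he
        exact h.ne_zero _ (by simpa [edges, leaves, internals] using he)
      · intro u hu
        exact h.distinct (false :: u) (by simpa [internals] using hu)
      · intro e he
        exact h.ne_zero _ (by simpa [edges, leaves, internals] using he)
      · intro u hu
        exact h.distinct (true :: u) (by simpa [internals] using hu)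
      · rw [← sum_leaves_eq _ _ s₀, ← sum_leaves_eq _ _ s₁]
        exact (h.distinct [] (by simp [internals])).2.2
    · rintro ⟨u, v, rfl, h₀, h₁, hne⟩
      have hsum := (validFor_node (a := ()) h₀ h₁ hne).sum_ne_zero
      obtain ⟨κ₀, m₀, s₀, p₀, r₀⟩ := (hL u).2 h₀
      obtain ⟨κ₁, m₁, s₁, p₁, r₁⟩ := (hR v).2 h₁
      let κ : Address → Color := fun u' => match u' with
        | [] => (u ++ v).sum
        | false :: t => κ₀ t
        | true :: t => κ₁ t
      have e₀ : κ ∘ List.cons false = κ₀ := rfl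
      have e₁ : κ ∘ List.cons true = κ₁ := rfl
      refine ⟨κ, by simp [leaves, e₀, e₁, m₀, m₁], ?_, ⟨?_, ?_⟩, rfl⟩
      · intro t ht
        simp only [internals, List.mem_cons, List.mem_append, List.mem_map] at ht
        rcases ht with rfl | ⟨t, ht, rfl⟩ | ⟨t, ht, rfl⟩
        · change (u ++ v).sum + κ₀ [] + κ₁ [] = 0
          rw [r₀, r₁, List.sum_append]
          generalize u.sum = a
          generalize v.sum = b
          revert a b; decide
        · exact s₀ t ht
        · exact s₁ t ht
      · intro t ht
        simp only [edges, leaves, internals, Set.mem_ofPred_eq, List.mem_cons, List.mem_append,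
          List.mem_map] at ht
        rcases ht with (⟨t, ht, rfl⟩ | ⟨t, ht, rfl⟩) | rfl | ⟨t, ht, rfl⟩ | ⟨t, ht, rfl⟩
        · exact p₀.ne_zero _ (Or.inl ht)
        · exact p₁.ne_zero _ (Or.inl ht)
        · exact hsum
        · exact p₀.ne_zero _ (Or.inr ht)
        · exact p₁.ne_zero _ (Or.inr ht)
      · intro t ht
        simp only [internals, List.mem_cons, List.mem_append, List.mem_map] at ht
        rcases ht with rfl | ⟨t, ht, rfl⟩ | ⟨t, ht, rfl⟩
        · change (u ++ v).sum ≠ κ₀ [] ∧ (u ++ v).sum ≠ κ₁ [] ∧ κ₀ [] ≠ κ₁ []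
          have a₀ := h₀.sum_ne_zero
          have a₁ := h₁.sum_ne_zero
          rw [r₀, r₁, List.sum_append]
          generalize u.sum = a at *
          generalize v.sum = b at *
          refine ⟨?_, ?_, hne⟩ <;> simpa
        · exact p₀.distinct t ht
        · exact p₁.distinct t ht

theorem valid_iff_validFor {n : ℕ} (T : Tree) (c : Fin n → Color) :
    Valid T c ↔ ValidFor T (List.ofFn c) := by
  rw [← exists_proper_iff]
  constructor
  · rintro ⟨κ, h, hp⟩
    exact ⟨κ, h.leaf, h.sum_eq_zero, hp, by rw [← h.leaf]; exact sum_leaves_eq κ T h.sum_eq_zero⟩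
  · rintro ⟨κ, h, hs, hp, -⟩
    exact ⟨κ, ⟨h, hs⟩, hp⟩

/-! ### Colored rotations -/

/-- Two trees that are both valid for `w`, the second one arising from the first by a rotation. -/
def Step (w : List Color) (T S : Tree) : Prop := ValidFor T w ∧ ValidFor S w ∧ Rotates T S

/-- Connectedness in the graph of rotations between trees valid for `w`. -/
def Conn (w : List Color) : Tree → Tree → Prop := Relation.EqvGen (Step w)

/-- `T` has a neighbor in the graph of rotations between trees valid for `w`. -/
def HasEdge (T : Tree) (w : List Color) : Prop := ∃ S, Step w T S ∨ Step w S T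

theorem HasEdge.validFor {T : Tree} {w : List Color} (h : HasEdge T w) : ValidFor T w := by
  obtain ⟨S, h | h⟩ := h
  exacts [h.1, h.2.1]

theorem Step.conn {w : List Color} {T S : Tree} (h : Step w T S) : Conn w T S := .rel _ _ h

theorem Conn.symm {w : List Color} {T S : Tree} (h : Conn w T S) : Conn w S T :=
  Relation.EqvGen.symm _ _ h

theorem Conn.trans {w : List Color} {T S U : Tree} (h : Conn w T S) (h' : Conn w S U) :
    Conn w T U :=
  Relation.EqvGen.trans _ _ _ h h'

theorem Conn.map {w w' : List Color} (f : Tree → Tree)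
    (hf : ∀ T S, Step w T S → Step w' (f T) (f S)) {T S : Tree} (h : Conn w T S) :
    Conn w' (f T) (f S) := by
  induction h with
  | rel _ _ h => exact (hf _ _ h).conn
  | refl => exact .refl _
  | symm _ _ _ ih => exact ih.symm
  | trans _ _ _ _ _ h₁ h₂ => exact h₁.trans h₂

theorem HasEdge.map {w w' : List Color} (f : Tree → Tree)
    (hf : ∀ T S, Step w T S → Step w' (f T) (f S)) {T : Tree} (h : HasEdge T w) :
    HasEdge (f T) w' := by
  obtain ⟨S, h | h⟩ := h
  exacts [⟨f S, .inl (hf _ _ h)⟩, ⟨f S, .inr (hf _ _ h)⟩]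

theorem Step.node_left {u v : List Color} {L L' R : Tree} (h : Step u L L') (hR : ValidFor R v)
    (hne : u.sum ≠ v.sum) : Step (u ++ v) (.node () L R) (.node () L' R) :=
  ⟨validFor_node h.1 hR hne, validFor_node h.2.1 hR hne, .left _ h.2.2⟩

theorem Step.node_right {u v : List Color} {L R R' : Tree} (h : Step v R R') (hL : ValidFor L u)
    (hne : u.sum ≠ v.sum) : Step (u ++ v) (.node () L R) (.node () L R') :=
  ⟨validFor_node hL h.1 hne, validFor_node hL h.2.1 hne, .right _ h.2.2⟩

theorem step_pivot {A B C : Tree} {u v t : List Color} (hA : ValidFor A u) (hB : ValidFor B v)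
    (hC : ValidFor C t) (h₁ : u.sum ≠ v.sum) (h₂ : u.sum = t.sum) :
    Step (u ++ (v ++ t)) (.node () (.node () A B) C) (.node () A (.node () B C)) := by
  have hu := hA.sum_ne_zero
  have hv := hB.sum_ne_zero
  refine ⟨?_, ?_, .pivot _ _ _⟩
  · rw [← List.append_assoc]
    refine validFor_node (validFor_node hA hB h₁) hC ?_
    rw [List.sum_append, ← h₂]
    simpa using hv
  · refine validFor_node hA (validFor_node hB hC (h₂ ▸ h₁.symm)) ?_
    rw [List.sum_append, ← h₂]
    simpa using hv

/-- A valid tree for which the root pivot is possible has the outer colors equal. -/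
theorem sum_eq_of_pivot {a b c : Color} (h₁ : a ≠ b) (h₂ : a + b ≠ c) (h₃ : b ≠ c)
    (ha : a ≠ 0) (hb : b ≠ 0) (hc : c ≠ 0) : a = c := by
  have : ∀ a b c : Color, a ≠ b ∧ a + b ≠ c ∧ b ≠ c ∧ a ≠ 0 ∧ b ≠ 0 ∧ c ≠ 0 → a = c := by
    decide
  exact this a b c ⟨h₁, h₂, h₃, ha, hb, hc⟩

/-! ### Grafting -/

/-- Replace the leaf with index `i` of a tree by the tree `U`. -/
def graft (U : Tree) : Tree → ℕ → Tree
  | .nil, _ => U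
  | .node a L R, i =>
    if i < L.numLeaves then .node a (graft U L i) R
    else .node a L (graft U R (i - L.numLeaves))

/-- The tree with two leaves. -/
def cherry : Tree := .node () .nil .nil

theorem graft_node_left {U L R : Tree} {a : Unit} {i : ℕ} (h : i < L.numLeaves) :
    graft U (.node a L R) i = .node a (graft U L i) R := by
  simp [graft, h]

theorem graft_node_right {U L R : Tree} {a : Unit} {i : ℕ} :
    graft U (.node a L R) (L.numLeaves + i) = .node a L (graft U R i) := by
  simp [graft]

theorem numLeaves_graft {U T : Tree} {i : ℕ} (h : i < T.numLeaves) :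
    (graft U T i).numLeaves + 1 = T.numLeaves + U.numLeaves := by
  induction T generalizing i with
  | nil => simp [graft, BinaryTree.numLeaves, add_comm]
  | node a L R hL hR =>
    simp only [BinaryTree.numLeaves] at h
    rw [graft]
    split_ifs with hi
    · have := hL hi
      simp only [BinaryTree.numLeaves]; omega
    · have := hR (i := i - L.numLeaves) (by omega)
      simp only [BinaryTree.numLeaves]; omega

theorem graft_graft_inside {U V T : Tree} {i k : ℕ} (hi : i < T.numLeaves)
    (hk : k < U.numLeaves) : graft V (graft U T i) (i + k) = graft (graft V U k) T i := by
  induction T generalizing i with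
  | nil =>
    have : i = 0 := by simpa [BinaryTree.numLeaves] using hi
    simp [graft, this]
  | node a L R hL hR =>
    simp only [BinaryTree.numLeaves] at hi
    by_cases h : i < L.numLeaves
    · have := numLeaves_graft (U := U) h
      rw [graft_node_left h, graft_node_left h, graft_node_left (by omega), hL h]
    · obtain ⟨j, rfl⟩ := Nat.exists_eq_add_of_le (not_lt.1 h)
      rw [graft_node_right, graft_node_right, add_assoc, graft_node_right, hR (by omega)]

/-- Grafting `V` at a leaf further left replaces one leaf by `V.numLeaves`, which shifts the later
position `k`. -/
theorem graft_graft_comm {U V T : Tree} {i k : ℕ} (hi : i < k) (hk : k < T.numLeaves) :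
    graft V (graft U T k) i = graft U (graft V T i) (k + V.numLeaves - 1) := by
  have hV := BinaryTree.numLeaves_pos V
  induction T generalizing i k with
  | nil =>
    simp only [BinaryTree.numLeaves] at hk
    omega
  | node a L R hL hR =>
    simp only [BinaryTree.numLeaves] at hk
    by_cases h : k < L.numLeaves
    · have := numLeaves_graft (U := U) h
      have hU := BinaryTree.numLeaves_pos U
      have := numLeaves_graft (U := V) (hi.trans h)
      rw [graft_node_left h, graft_node_left (by omega), graft_node_left (by omega),
        graft_node_left (by omega), hL hi h]
    · obtain ⟨j, rfl⟩ := Nat.exists_eq_add_of_le (not_lt.1 h)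
      by_cases h' : i < L.numLeaves
      · have := numLeaves_graft (U := V) h'
        rw [graft_node_right, graft_node_left h', graft_node_left h',
          show L.numLeaves + j + V.numLeaves - 1 = (graft V L i).numLeaves + j by omega,
          graft_node_right]
      · obtain ⟨m, rfl⟩ := Nat.exists_eq_add_of_le (not_lt.1 h')
        rw [graft_node_right, graft_node_right, graft_node_right,
          show L.numLeaves + j + V.numLeaves - 1 = L.numLeaves + (j + V.numLeaves - 1) by omega,
          graft_node_right, hR (by omega) (by omega)]

theorem Rotates.graft {T S : Tree} (h : Rotates T S) (U : Tree) (i : ℕ) :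
    Rotates (graft U T i) (graft U S i) := by
  induction h generalizing i with
  | pivot A B C =>
    by_cases h₁ : i < A.numLeaves
    · rw [graft_node_left (by simp only [BinaryTree.numLeaves]; omega), graft_node_left h₁,
        graft_node_left h₁]
      exact .pivot _ _ _
    · obtain ⟨j, rfl⟩ := Nat.exists_eq_add_of_le (not_lt.1 h₁)
      rw [graft_node_right]
      by_cases h₂ : j < B.numLeaves
      · rw [graft_node_left (by simp only [BinaryTree.numLeaves]; omega), graft_node_right,
          graft_node_left h₂]
        exact .pivot _ _ _
      · obtain ⟨k, rfl⟩ := Nat.exists_eq_add_of_le (not_lt.1 h₂)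
        rw [graft_node_right, ← add_assoc]
        exact (graft_node_right (L := .node () A B)) ▸ .pivot _ _ _
  | @left L L' R h ih =>
    have := h.numLeaves_eq
    by_cases h₁ : i < L.numLeaves
    · rw [graft_node_left h₁, graft_node_left (this ▸ h₁)]
      exact .left _ (ih _)
    · obtain ⟨j, rfl⟩ := Nat.exists_eq_add_of_le (not_lt.1 h₁)
      rw [graft_node_right, this, graft_node_right]
      exact .left _ h
  | @right L R R' h ih =>
    by_cases h₁ : i < L.numLeaves
    · rw [graft_node_left h₁, graft_node_left h₁]
      exact .right _ h
    · obtain ⟨j, rfl⟩ := Nat.exists_eq_add_of_le (not_lt.1 h₁)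
      rw [graft_node_right, graft_node_right]
      exact .right _ (ih _)

theorem Rotates.graft_of_rotates {U V : Tree} (h : Rotates U V) (T : Tree) (i : ℕ) :
    Rotates (ColoredTree.graft U T i) (ColoredTree.graft V T i) := by
  induction T generalizing i with
  | nil => exact h
  | node a L R hL hR =>
    rw [ColoredTree.graft, ColoredTree.graft]
    split_ifs
    · exact .left _ (hL _)
    · exact .right _ (hR _)

theorem ValidFor.graft {T U : Tree} {p q u : List Color} {b : Color}
    (hT : ValidFor T (p ++ b :: q)) (hU : ValidFor U u) (hb : u.sum = b) :
    ValidFor (graft U T p.length) (p ++ (u ++ q)) := by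
  induction T generalizing p q with
  | nil =>
    obtain ⟨a, -, e⟩ := hT
    obtain ⟨rfl, rfl, rfl⟩ : p = [] ∧ b = a ∧ q = [] := by
      cases p <;> simp_all
    simpa [ColoredTree.graft] using hU
  | node a L R hL hR =>
    obtain ⟨s, t, e, h₁, h₂, h₃⟩ := hT
    have hs := h₁.length_eq
    rcases List.append_eq_append_iff.1 e with ⟨m, rfl, e'⟩ | ⟨m, rfl, e'⟩
    · cases m with
      | nil =>
        simp only [List.nil_append, List.append_nil] at e' hs h₁ h₃
        subst e'
        have := graft_node_right (U := U) (L := L) (R := R) (a := a) (i := 0)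
        rw [hs, ← add_zero L.numLeaves, this]
        refine validFor_node h₁ (hR (p := []) h₂) ?_
        simpa [← hb] using h₃
      | cons b' m =>
        simp only [List.cons_append, List.cons.injEq] at e'
        obtain ⟨rfl, rfl⟩ := e'
        rw [graft_node_left (by rw [← hs]; simp)]
        have := validFor_node (a := a) (hL h₁) h₂ (by simpa [← hb, add_assoc] using h₃)
        simpa using this
    · subst e'
      rw [List.length_append, hs, graft_node_right, List.append_assoc]
      exact validFor_node h₁ (hR h₂) (by simpa [← hb, add_assoc] using h₃)

theorem Step.graft {T S U : Tree} {p q u : List Color} {b : Color}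
    (h : Step (p ++ b :: q) T S) (hU : ValidFor U u) (hb : u.sum = b) :
    Step (p ++ (u ++ q)) (graft U T p.length) (graft U S p.length) :=
  ⟨h.1.graft hU hb, h.2.1.graft hU hb, h.2.2.graft _ _⟩

theorem Step.graft_of_step {T U V : Tree} {p q u : List Color} {b : Color}
    (hT : ValidFor T (p ++ b :: q)) (h : Step u U V) (hb : u.sum = b) :
    Step (p ++ (u ++ q)) (ColoredTree.graft U T p.length) (ColoredTree.graft V T p.length) :=
  ⟨hT.graft h.1 hb, hT.graft h.2.1 hb, h.2.2.graft_of_rotates _ _⟩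

theorem validFor_cherry {x y : Color} (hx : x ≠ 0) (hy : y ≠ 0) (h : x ≠ y) :
    ValidFor cherry [x, y] :=
  validFor_node (validFor_nil hx) (validFor_nil hy) (by simpa using h)

theorem ValidFor.graft_cherry {T : Tree} {p q : List Color} {x y : Color}
    (hT : ValidFor T (p ++ (x + y) :: q)) (hx : x ≠ 0) (hy : y ≠ 0) (h : x ≠ y) :
    ValidFor (ColoredTree.graft cherry T p.length) (p ++ x :: y :: q) :=
  hT.graft (validFor_cherry hx hy h) (by simp)

theorem Step.graft_cherry {T S : Tree} {p q : List Color} {x y : Color}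
    (hT : Step (p ++ (x + y) :: q) T S) (hx : x ≠ 0) (hy : y ≠ 0) (h : x ≠ y) :
    Step (p ++ x :: y :: q) (ColoredTree.graft cherry T p.length)
      (ColoredTree.graft cherry S p.length) :=
  hT.graft (validFor_cherry hx hy h) (by simp)

/-- Every tree with an internal vertex has two adjacent leaves with a common parent. -/
theorem ValidFor.exists_graft_cherry {T : Tree} {w : List Color} (h : ValidFor T w)
    (hw : 2 ≤ w.length) : ∃ p x y q T₀, w = p ++ x :: y :: q ∧ x ≠ y ∧
      ValidFor T₀ (p ++ (x + y) :: q) ∧ T = ColoredTree.graft cherry T₀ p.length := by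
  induction T generalizing w with
  | nil => obtain ⟨a, -, rfl⟩ := h; simp at hw
  | node a L R hL hR =>
    obtain ⟨u, v, rfl, h₁, h₂, h₃⟩ := h
    by_cases hu : 2 ≤ u.length
    · obtain ⟨p, x, y, q, T₀, rfl, hxy, hT, rfl⟩ := hL h₁ hu
      refine ⟨p, x, y, q ++ v, .node a T₀ R, by simp, hxy, ?_, ?_⟩
      · simpa using validFor_node (a := a) hT h₂ (by simpa [add_assoc] using h₃)
      · rw [graft_node_left (by rw [← hT.length_eq]; simp)]
    by_cases hv : 2 ≤ v.length
    · obtain ⟨p, x, y, q, T₀, rfl, hxy, hT, rfl⟩ := hR h₂ hv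
      refine ⟨u ++ p, x, y, q, .node a L T₀, by simp, hxy, ?_, ?_⟩
      · simpa using validFor_node (a := a) h₁ hT (by simpa [add_assoc] using h₃)
      · rw [List.length_append, h₁.length_eq, graft_node_right]
    cases L with
    | node _ A B =>
      have := h₁.length_eq
      have := BinaryTree.numLeaves_pos A
      have := BinaryTree.numLeaves_pos B
      simp only [BinaryTree.numLeaves] at *
      omega
    | nil =>
      cases R with
      | node _ A B =>
        have := h₂.length_eq
        have := BinaryTree.numLeaves_pos A
        have := BinaryTree.numLeaves_pos B
        simp only [BinaryTree.numLeaves] at *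
        omega
      | nil =>
        obtain ⟨x, hx, rfl⟩ := h₁
        obtain ⟨y, hy, rfl⟩ := h₂
        have hxy : x ≠ y := by simpa using h₃
        exact ⟨[], x, y, [], .nil, rfl, hxy, validFor_nil ((add_ne_zero_iff_ne _ _).2 hxy), rfl⟩

/-! ### Rigid trees and rigid words

At every vertex of a properly colored tree the three colors occur in one of the two cyclic orders.
A tree has no neighbor exactly if the orders at adjacent vertices are always different. In such a
tree an edge carries a *state*: its color together with the cyclic order below it. -/

/-- The linear automorphism of the group of colors that permutes the nonzero colors cyclically. -/
def rot (c : Color) : Color := (c.2, c.1 + c.2)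

/-- The next color in the cyclic order given by `s`. -/
def turn (s : Bool) (c : Color) : Color := if s then rot c else c + rot c

/-- The state of the left child edge of an edge with state `q` in a rigid tree. -/
def leftState (q : Color × Bool) : Color × Bool := (turn q.2 q.1, !q.2)

/-- The state of the right child edge of an edge with state `q` in a rigid tree. -/
def rightState (q : Color × Bool) : Color × Bool := (turn (!q.2) q.1, !q.2)

/-- `T` has a proper coloring with leaf colors `w` and root state `q`, in which adjacent vertices
have different cyclic orders. -/
def RigidFor : Tree → List Color → Color × Bool → Prop
  | .nil, w, q => w = [q.1] ∧ q.1 ≠ 0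
  | .node _ L R, w, q => ∃ u v, w = u ++ v ∧ RigidFor L u (leftState q) ∧
      RigidFor R v (rightState q)

/-- The relation between the states of consecutive leaf edges in a rigid tree. -/
def Follows (a b : Color × Bool) : Prop :=
  b.1 = if a.2 = b.2 then turn (!a.2) a.1 else a.1

instance (a b : Color × Bool) : Decidable (Follows a b) := by
  unfold Follows; infer_instance

/-- The letters of `w` can be extended to states in which consecutive ones follow each other. -/
def Rigid (w : List Color) : Prop :=
  ∃ l : List (Color × Bool), l.map Prod.fst = w ∧ l.IsChain Follows

theorem leftState_add_rightState (q : Color × Bool) :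
    (leftState q).1 + (rightState q).1 = q.1 := by
  revert q; decide

theorem RigidFor.sum_eq {T : Tree} {w : List Color} {q : Color × Bool} (h : RigidFor T w q) :
    w.sum = q.1 := by
  induction T generalizing w q with
  | nil => simp [h.1]
  | node _ L R hL hR =>
    obtain ⟨u, v, rfl, h₁, h₂⟩ := h
    rw [List.sum_append, hL h₁, hR h₂, leftState_add_rightState]

theorem RigidFor.ne_zero {T : Tree} {w : List Color} {q : Color × Bool} (h : RigidFor T w q) :
    q.1 ≠ 0 := by
  induction T generalizing w q with
  | nil => exact h.2
  | node _ L R hL hR =>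
    obtain ⟨u, v, rfl, h₁, h₂⟩ := h
    have := hL h₁
    clear * - this; revert q; decide

theorem RigidFor.validFor {T : Tree} {w : List Color} {q : Color × Bool} (h : RigidFor T w q) :
    ValidFor T w := by
  induction T generalizing w q with
  | nil => exact ⟨q.1, h.2, h.1⟩
  | node _ L R hL hR =>
    have h₀ := h.ne_zero
    obtain ⟨u, v, rfl, h₁, h₂⟩ := h
    refine ⟨u, v, rfl, hL h₁, hR h₂, ?_⟩
    rw [h₁.sum_eq, h₂.sum_eq]
    clear * - h₀; revert q; decide

theorem follows_spine {q a b : Color × Bool} (hq : q.1 ≠ 0)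
    (ha : a = leftState q ∨ a = rightState (leftState q))
    (hb : b = rightState q ∨ b = leftState (rightState q)) : Follows a b := by
  rcases ha with rfl | rfl <;> rcases hb with rfl | rfl <;> revert q <;> decide

theorem leftState_leftState (q : Color × Bool) : leftState (leftState q) = q := by
  revert q; decide

theorem rightState_rightState (q : Color × Bool) : rightState (rightState q) = q := by
  revert q; decide

/-- Two steps to the left restore a state, and so do two steps to the right. Hence the outermost
leaf on a spine has one of two states, whatever its depth, and `follows_spine` covers all pairs of
leaves that meet across a vertex. -/
theorem RigidFor.exists_chain {T : Tree} {w : List Color} {q : Color × Bool}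
    (h : RigidFor T w q) : ∃ l : List (Color × Bool), l.map Prod.fst = w ∧ l.IsChain Follows ∧
      l ≠ [] ∧ (∀ a ∈ l.head?, a = q ∨ a = leftState q) ∧
      (∀ a ∈ l.getLast?, a = q ∨ a = rightState q) := by
  induction T generalizing w q with
  | nil => exact ⟨[q], by simp [h.1], by simp, by simp, by simp, by simp⟩
  | node _ L R hL hR =>
    have h₀ := h.ne_zero
    obtain ⟨u, v, rfl, h₁, h₂⟩ := h
    obtain ⟨l₁, rfl, c₁, n₁, f₁, g₁⟩ := hL h₁
    obtain ⟨l₂, rfl, c₂, n₂, f₂, g₂⟩ := hR h₂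
    refine ⟨l₁ ++ l₂, by simp, ?_, by simp [n₁], ?_, ?_⟩
    · rw [List.isChain_append]
      exact ⟨c₁, c₂, fun a ha b hb => follows_spine h₀ (g₁ a ha) (f₂ b hb)⟩
    · rw [List.head?_append_of_ne_nil _ n₁]
      intro a ha
      have := f₁ a ha
      rw [leftState_leftState] at this
      exact this.symm
    · rw [List.getLast?_append_of_ne_nil _ n₂]
      intro a ha
      have := g₂ a ha
      rw [rightState_rightState] at this
      exact this.symm

/-- This is the local converse of `follows_spine`: the states at the facing ends of two subtrees
force their root orders to agree, and then the opposite order fits their parent. It is a finite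
check. -/
theorem exists_parent_state {a b f g : Color × Bool} (ha : a.1 ≠ 0) (hb : b.1 ≠ 0)
    (hab : a.1 ≠ b.1) (hf : f = a ∨ f = rightState a) (hg : g = b ∨ g = leftState b)
    (h : Follows f g) : a = leftState (a.1 + b.1, !a.2) ∧ b = rightState (a.1 + b.1, !a.2) := by
  have key : ∀ a b : Color × Bool, (a.1 ≠ 0 ∧ b.1 ≠ 0 ∧ a.1 ≠ b.1) ∧
      (Follows a b ∨ Follows a (leftState b) ∨ Follows (rightState a) b ∨
        Follows (rightState a) (leftState b)) →
      a = leftState (a.1 + b.1, !a.2) ∧ b = rightState (a.1 + b.1, !a.2) := by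
    decide
  refine key a b ⟨⟨ha, hb, hab⟩, ?_⟩
  rcases hf with rfl | rfl <;> rcases hg with rfl | rfl <;> simp [h]

/-- The chain fixes the states of the leaves, and `exists_parent_state` lifts them one vertex at a
time. The bounds on the first and last states say what the neighboring subtree can see. -/
theorem ValidFor.rigidFor_of_isChain {T : Tree} {l : List (Color × Bool)}
    (h : ValidFor T (l.map Prod.fst)) (hl : l.IsChain Follows) : ∃ q,
      RigidFor T (l.map Prod.fst) q ∧ (∀ a ∈ l.head?, a = q ∨ a = leftState q) ∧
      (∀ a ∈ l.getLast?, a = q ∨ a = rightState q) := by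
  induction T generalizing l with
  | nil =>
    obtain ⟨a, ha, e⟩ := h
    obtain ⟨q, rfl⟩ := List.length_eq_one_iff.1 (by simpa using congrArg List.length e)
    obtain rfl : q.1 = a := by simpa using e
    exact ⟨q, ⟨rfl, ha⟩, by simp, by simp⟩
  | node _ L R hL hR =>
    obtain ⟨u, v, e, h₁, h₂, h₃⟩ := h
    obtain ⟨l₁, l₂, rfl, rfl, rfl⟩ := List.map_eq_append_iff.1 e
    rw [List.isChain_append] at hl
    obtain ⟨c₁, c₂, c₃⟩ := hl
    have n₁ : l₁ ≠ [] := by rintro rfl; simpa using h₁.sum_ne_zero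
    have n₂ : l₂ ≠ [] := by rintro rfl; simpa using h₂.sum_ne_zero
    obtain ⟨a, ra, fa, ga⟩ := hL h₁ c₁
    obtain ⟨b, rb, fb, gb⟩ := hR h₂ c₂
    rw [ra.sum_eq, rb.sum_eq] at h₃
    have m₁ := List.getLast?_eq_getLast_of_ne_nil n₁
    have m₂ := List.head?_eq_some_head n₂
    obtain ⟨ea, eb⟩ := exists_parent_state ra.ne_zero rb.ne_zero h₃ (ga _ m₁) (fb _ m₂)
      (c₃ _ m₁ _ m₂)
    generalize (a.1 + b.1, !a.2) = q at ea eb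
    subst ea eb
    refine ⟨q, ⟨_, _, List.map_append .., ra, rb⟩, ?_, ?_⟩
    · rw [List.head?_append_of_ne_nil _ n₁]
      intro x hx
      have := fa x hx
      rw [leftState_leftState] at this
      exact this.symm
    · rw [List.getLast?_append_of_ne_nil _ n₂]
      intro x hx
      have := gb x hx
      rw [rightState_rightState] at this
      exact this.symm

theorem RigidFor.rigid {T : Tree} {w : List Color} {q : Color × Bool} (h : RigidFor T w q) :
    Rigid w := by
  obtain ⟨l, h, c, -⟩ := h.exists_chain
  exact ⟨l, h, c⟩

theorem Rigid.rigidFor {T : Tree} {w : List Color} (h : Rigid w) (hT : ValidFor T w) :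
    ∃ q, RigidFor T w q := by
  obtain ⟨l, rfl, c⟩ := h
  obtain ⟨q, h, -⟩ := hT.rigidFor_of_isChain c
  exact ⟨q, h⟩

/-- With opposite orders at the two vertices of a pivot, `B` and `C` have equal colors in `(A B) C`,
and `A` and `B` have equal colors in `A (B C)`. The rotated tree would make these two edges
siblings. -/
theorem RigidFor.not_validFor_of_rotates {T S : Tree} (hr : Rotates T S) :
    ∀ w q, (RigidFor T w q → ¬ ValidFor S w) ∧ (RigidFor S w q → ¬ ValidFor T w) := by
  induction hr with
  | pivot A B C =>
    refine fun w q => ⟨?_, ?_⟩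
    · rintro ⟨_, t, rfl, ⟨u, v, rfl, hA, hB⟩, hC⟩ h
      rw [List.append_assoc] at h
      have h := (h.node_inv hA.validFor.length_eq).2.1
      have h := (h.node_inv hB.validFor.length_eq).2.2
      rw [hB.sum_eq, hC.sum_eq] at h
      clear * - h; revert q; decide
    · rintro ⟨u, _, rfl, hA, v, t, rfl, hB, hC⟩ h
      rw [← List.append_assoc] at h
      have h := (h.node_inv (by
        simp [BinaryTree.numLeaves, hA.validFor.length_eq, hB.validFor.length_eq])).1
      have h := (h.node_inv hA.validFor.length_eq).2.2
      rw [hA.sum_eq, hB.sum_eq] at h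
      clear * - h; revert q; decide
  | left R h ih =>
    refine fun w q => ⟨?_, ?_⟩
    · rintro ⟨u, v, rfl, hL, hR⟩ h'
      exact (ih _ _).1 hL (h'.node_inv (hL.validFor.length_eq.trans h.numLeaves_eq)).1
    · rintro ⟨u, v, rfl, hL, hR⟩ h'
      exact (ih _ _).2 hL (h'.node_inv (hL.validFor.length_eq.trans h.numLeaves_eq.symm)).1
  | right L h ih =>
    refine fun w q => ⟨?_, ?_⟩
    · rintro ⟨u, v, rfl, hL, hR⟩ h'
      exact (ih _ _).1 hR (h'.node_inv hL.validFor.length_eq).2.1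
    · rintro ⟨u, v, rfl, hL, hR⟩ h'
      exact (ih _ _).2 hR (h'.node_inv hL.validFor.length_eq).2.1

theorem HasEdge.not_rigid {T : Tree} {w : List Color} (h : HasEdge T w) : ¬ Rigid w := by
  intro hw
  obtain ⟨q, hq⟩ := hw.rigidFor h.validFor
  obtain ⟨S, h | h⟩ := h
  · exact (RigidFor.not_validFor_of_rotates h.2.2 w q).1 hq h.2.1
  · exact (RigidFor.not_validFor_of_rotates h.2.2 w q).2 hq h.1

theorem HasEdge.node_left {u v : List Color} {L R : Tree} (h : HasEdge L u) (hR : ValidFor R v)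
    (hne : u.sum ≠ v.sum) : HasEdge (.node () L R) (u ++ v) :=
  h.map (fun L => .node () L R) fun _ _ h => h.node_left hR hne

theorem HasEdge.node_right {u v : List Color} {L R : Tree} (h : HasEdge R v) (hL : ValidFor L u)
    (hne : u.sum ≠ v.sum) : HasEdge (.node () L R) (u ++ v) :=
  h.map (fun R => .node () L R) fun _ _ h => h.node_right hL hne

/-- If neither subtree has an edge, both are rigid. Then either some child has the same order as the
root, which makes a pivot at the root valid, or all orders alternate. -/
theorem ValidFor.hasEdge_or_rigidFor {T : Tree} {w : List Color} (h : ValidFor T w) :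
    HasEdge T w ∨ ∃ q, RigidFor T w q := by
  induction T generalizing w with
  | nil =>
    obtain ⟨a, ha, rfl⟩ := h
    exact .inr ⟨(a, true), rfl, ha⟩
  | node _ L R hL hR =>
    obtain ⟨u, v, rfl, h₁, h₂, h₃⟩ := h
    rcases hL h₁ with e | ⟨a, ra⟩
    · exact .inl (e.node_left h₂ h₃)
    rcases hR h₂ with e | ⟨b, rb⟩
    · exact .inl (e.node_right h₁ h₃)
    have ha := ra.ne_zero
    have hb := rb.ne_zero
    obtain ⟨s, hs₁, hs₂⟩ : ∃ s, turn s (u.sum + v.sum) = u.sum ∧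
        turn (!s) (u.sum + v.sum) = v.sum := by
      have key : ∀ x y : Color, x ≠ 0 ∧ y ≠ 0 ∧ x ≠ y → ∃ s, turn s (x + y) = x ∧
          turn (!s) (x + y) = y := by decide
      exact key _ _ ⟨h₁.sum_ne_zero, h₂.sum_ne_zero, h₃⟩
    -- A leaf has no vertex below it, so its order may be chosen freely; an internal child has a
    -- definite order, and order `s` opens the pivot.
    have hL' : HasEdge (.node () L R) (u ++ v) ∨ RigidFor L u (u.sum, !s) := by
      cases L with
      | nil => exact .inr ⟨by rw [ra.sum_eq]; exact ra.1, by rw [ra.sum_eq]; exact ra.2⟩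
      | node _ A B =>
        by_cases hs : a.2 = !s
        · right
          rwa [show (u.sum, !s) = a from Prod.ext ra.sum_eq hs.symm]
        · left
          obtain ⟨u₁, u₂, rfl, rA, rB⟩ := ra
          rw [List.append_assoc]
          have hs : a.2 = s := by simpa using hs
          have e : a.1 = (u₁ ++ u₂).sum := by
            rw [List.sum_append, rA.sum_eq, rB.sum_eq, leftState_add_rightState]
          refine ⟨_, .inl (step_pivot rA.validFor rB.validFor h₂ ?_ ?_)⟩
          · rw [rA.sum_eq, rB.sum_eq]; clear * - ha; revert a; decide
          · rw [rA.sum_eq]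
            change turn a.2 a.1 = _
            rw [hs, e]
            generalize (u₁ ++ u₂).sum = x at *
            generalize v.sum = y at *
            clear * - hs₁ hs₂
            revert s x y; decide
    have hR' : HasEdge (.node () L R) (u ++ v) ∨ RigidFor R v (v.sum, !s) := by
      cases R with
      | nil => exact .inr ⟨by rw [rb.sum_eq]; exact rb.1, by rw [rb.sum_eq]; exact rb.2⟩
      | node _ A B =>
        by_cases hs : b.2 = !s
        · right
          rwa [show (v.sum, !s) = b from Prod.ext rb.sum_eq hs.symm]
        · left
          obtain ⟨v₁, v₂, rfl, rA, rB⟩ := rb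
          have hs : b.2 = s := by simpa using hs
          have e : b.1 = (v₁ ++ v₂).sum := by
            rw [List.sum_append, rA.sum_eq, rB.sum_eq, leftState_add_rightState]
          have e' : u.sum = v₂.sum := by
            rw [rB.sum_eq]
            change _ = turn (!b.2) b.1
            rw [hs, e]
            generalize (v₁ ++ v₂).sum = y at *
            generalize u.sum = x at *
            clear * - hs₁ hs₂
            revert s x y; decide
          refine ⟨_, .inr (step_pivot h₁ rA.validFor rB.validFor ?_ e')⟩
          · rw [e', rA.sum_eq, rB.sum_eq]; clear * - hb; revert b; decide
    rcases hL' with e | rL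
    · exact .inl e
    rcases hR' with e | rR
    · exact .inl e
    refine .inr ⟨(u.sum + v.sum, s), u, v, rfl, ?_, ?_⟩
    · rwa [show leftState (u.sum + v.sum, s) = (u.sum, !s) from Prod.ext hs₁ rfl]
    · rwa [show rightState (u.sum + v.sum, s) = (v.sum, !s) from Prod.ext hs₂ rfl]

theorem ValidFor.hasEdge {T : Tree} {w : List Color} (h : ValidFor T w) (hw : ¬ Rigid w) :
    HasEdge T w :=
  h.hasEdge_or_rigidFor.resolve_right fun ⟨_, hq⟩ => hw hq.rigid

/-! ### Existence of valid trees -/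

theorem exists_adjacent_ne {w : List Color} (h : ∃ a ∈ w, ∃ b ∈ w, a ≠ b) :
    ∃ p x y q, w = p ++ x :: y :: q ∧ x ≠ y := by
  by_contra! hc
  suffices ∀ w' : List Color, w' <:+ w → ∀ a ∈ w', ∀ b ∈ w', a = b by
    obtain ⟨a, ha, b, hb, hab⟩ := h
    exact hab (this w (List.suffix_refl _) a ha b hb)
  intro w'
  induction w' with
  | nil => simp
  | cons x w' ih =>
    rintro ⟨p, rfl⟩
    have ih := ih ⟨p ++ [x], by simp⟩
    cases w' with
    | nil => simp
    | cons y q =>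
      obtain rfl := hc p x y q rfl
      simp only [List.mem_cons] at ih ⊢
      intro a ha b hb
      exact ih a (by tauto) b (by tauto)

/-- Two different neighboring letters are merged into their sum and then split by a cherry. The
merge must be chosen so that the shorter word is again not constant. -/
theorem exists_validFor {w : List Color} (h₀ : ∀ c ∈ w, c ≠ 0) (hs : w.sum ≠ 0)
    (hw : ∃ a ∈ w, ∃ b ∈ w, a ≠ b) : ∃ T, ValidFor T w := by
  induction hn : w.length using Nat.strong_induction_on generalizing w with
  | _ n ih =>
  obtain ⟨p, x, y, q, rfl, hxy⟩ := exists_adjacent_ne hw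
  have hx : x ≠ 0 := h₀ x (by simp)
  have hy : y ≠ 0 := h₀ y (by simp)
  have merge : ∀ (p q : List Color) (x y : Color), (∀ c ∈ p ++ x :: y :: q, c ≠ 0) →
      (p ++ x :: y :: q).sum ≠ 0 → x ≠ y → (p ++ x :: y :: q).length = n →
      (∃ a ∈ p ++ (x + y) :: q, ∃ b ∈ p ++ (x + y) :: q, a ≠ b) →
      ∃ T, ValidFor T (p ++ x :: y :: q) := by
    intro p q x y h₀ hs hxy hn h
    obtain ⟨T, hT⟩ := ih _ (by simp at hn ⊢; omega) (w := p ++ (x + y) :: q)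
      (by
        intro c hc
        simp only [List.mem_append, List.mem_cons] at hc
        rcases hc with hc | rfl | hc
        · exact h₀ c (by simp [hc])
        · exact (add_ne_zero_iff_ne _ _).2 hxy
        · exact h₀ c (by simp [hc]))
      (by simpa [add_assoc] using hs) h rfl
    exact ⟨_, hT.graft_cherry (h₀ x (by simp)) (h₀ y (by simp)) hxy⟩
  by_cases h : ∃ a ∈ p ++ (x + y) :: q, ∃ b ∈ p ++ (x + y) :: q, a ≠ b
  · exact merge p q x y h₀ hs hxy hn h
  push Not at h
  -- All other letters equal `x + y`. With none of them the tree is a cherry; with exactly one the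
  -- total would be zero. Otherwise one of them is merged with its neighbor `x` or `y`, and another
  -- one survives to keep the word from being constant.
  have hp : ∀ c ∈ p, c = x + y := fun c hc => h c (by simp [hc]) _ (by simp)
  have hq : ∀ c ∈ q, c = x + y := fun c hc => h c (by simp [hc]) _ (by simp)
  rcases List.eq_nil_or_concat p with rfl | ⟨p', z, rfl⟩
  · cases q with
    | nil => exact ⟨_, validFor_cherry hx hy hxy⟩
    | cons z q =>
      obtain rfl := hq z (by simp)
      cases q with
      | nil =>
        exfalso; apply hs
        simp only [List.nil_append, List.sum_cons, List.sum_nil]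
        clear * -; revert x y; decide
      | cons c q =>
        obtain rfl := hq c (by simp)
        refine merge [x] _ y (x + y) h₀ hs (by simpa using hx) hn
          ⟨x, by simp, x + y, by simp, by simpa using hy⟩
  · obtain rfl := hp z (by simp)
    rw [List.concat_eq_append, List.append_assoc] at *
    refine merge p' (y :: q) (x + y) x h₀ hs (by simpa using hy) hn ?_
    have hc : ∃ c ∈ p' ++ q, c = x + y := by
      by_contra! hc
      have hp' : p' = [] := List.eq_nil_iff_forall_not_mem.2 fun c h' =>
        hc c (by simp [h']) (hp c (by simp [h']))
      have hq' : q = [] := List.eq_nil_iff_forall_not_mem.2 fun c h' =>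
        hc c (by simp [h']) (hq c (by simp [h']))
      subst hp' hq'
      apply hs
      simp only [List.nil_append, List.singleton_append, List.sum_cons, List.sum_nil]
      clear * -; revert x y; decide
    obtain ⟨c, hc, rfl⟩ := hc
    refine ⟨_, ?_, y, by simp, (by simpa using hx : x + y ≠ y)⟩
    rcases List.mem_append.1 hc with hc | hc <;> simp [hc]

/-! ### Contracting a pair of leaves away from a possible rotation -/

/-- The tree `T₀` with leaf colors `w₀` arises from `T` with leaf colors `w` by removing two leaves
with a common parent. -/
def Contracts (T : Tree) (w : List Color) (T₀ : Tree) (w₀ : List Color) : Prop :=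
  w₀.length = T₀.numLeaves ∧ ∃ p x y q, w = p ++ x :: y :: q ∧ w₀ = p ++ (x + y) :: q ∧ x ≠ y ∧
    T = graft cherry T₀ p.length

theorem Contracts.sum_eq {T T₀ : Tree} {w w₀ : List Color} (h : Contracts T w T₀ w₀) :
    w₀.sum = w.sum := by
  obtain ⟨-, p, x, y, q, rfl, rfl, -⟩ := h
  simp [add_assoc]

theorem Contracts.node_left {L L₀ R : Tree} {u u₀ v : List Color} (h : Contracts L u L₀ u₀)
    (hR : v.length = R.numLeaves) : Contracts (.node () L R) (u ++ v) (.node () L₀ R) (u₀ ++ v) := by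
  obtain ⟨h, p, x, y, q, rfl, rfl, hxy, rfl⟩ := h
  refine ⟨by rw [List.length_append, h, hR]; rfl, p, x, y, q ++ v, by simp, by simp, hxy, ?_⟩
  rw [graft_node_left (by rw [← h]; simp)]

theorem Contracts.node_right {L R R₀ : Tree} {u v v₀ : List Color} (h : Contracts R v R₀ v₀)
    (hL : u.length = L.numLeaves) : Contracts (.node () L R) (u ++ v) (.node () L R₀) (u ++ v₀) := by
  obtain ⟨h, p, x, y, q, rfl, rfl, hxy, rfl⟩ := h
  refine ⟨by rw [List.length_append, h, hL]; rfl, u ++ p, x, y, q, by simp, by simp, hxy, ?_⟩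
  rw [List.length_append, hL, graft_node_right]

theorem ValidFor.exists_contracts {T : Tree} {w : List Color} (h : ValidFor T w)
    (hw : 2 ≤ w.length) : ∃ T₀ w₀, Contracts T w T₀ w₀ ∧ ValidFor T₀ w₀ := by
  obtain ⟨p, x, y, q, T₀, rfl, hxy, hT, rfl⟩ := h.exists_graft_cherry hw
  exact ⟨T₀, _, ⟨hT.length_eq, p, x, y, q, rfl, rfl, hxy, rfl⟩, hT⟩

/-- Some pair of leaves with a common parent can be contracted so that a valid rotation remains. -/
def Reducible (T : Tree) (w : List Color) : Prop :=
  ∃ T₀ w₀, Contracts T w T₀ w₀ ∧ HasEdge T₀ w₀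

theorem Reducible.node_left {L R : Tree} {u v : List Color} (h : Reducible L u)
    (hR : ValidFor R v) (hne : u.sum ≠ v.sum) : Reducible (.node () L R) (u ++ v) := by
  obtain ⟨L₀, u₀, hc, he⟩ := h
  exact ⟨_, _, hc.node_left hR.length_eq, he.node_left hR (by rwa [hc.sum_eq])⟩

theorem Reducible.node_right {L R : Tree} {u v : List Color} (h : Reducible R v)
    (hL : ValidFor L u) (hne : u.sum ≠ v.sum) : Reducible (.node () L R) (u ++ v) := by
  obtain ⟨R₀, v₀, hc, he⟩ := h
  exact ⟨_, _, hc.node_right hL.length_eq, he.node_right hL (by rwa [hc.sum_eq])⟩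

/-- Among four or more leaves, one of `A`, `B`, `C` has a cherry. Contracting it keeps the color of
that subtree, hence the pivot. -/
theorem reducible_pivot {A B C : Tree} {u v t : List Color} (hA : ValidFor A u)
    (hB : ValidFor B v) (hC : ValidFor C t) (h₁ : u.sum ≠ v.sum) (h₂ : u.sum = t.sum)
    (h : 4 ≤ (u ++ (v ++ t)).length) :
    Reducible (.node () (.node () A B) C) (u ++ (v ++ t)) ∧
      Reducible (.node () A (.node () B C)) (u ++ (v ++ t)) := by
  have lA := hA.length_eq
  have lB := hB.length_eq
  have lC := hC.length_eq
  have key : ∀ A₀ B₀ C₀ u₀ v₀ t₀, ValidFor A₀ u₀ → ValidFor B₀ v₀ → ValidFor C₀ t₀ →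
      u₀.sum = u.sum → v₀.sum = v.sum → t₀.sum = t.sum →
      Contracts (.node () (.node () A B) C) (u ++ v ++ t) (.node () (.node () A₀ B₀) C₀)
        (u₀ ++ v₀ ++ t₀) →
      Contracts (.node () A (.node () B C)) (u ++ (v ++ t)) (.node () A₀ (.node () B₀ C₀))
        (u₀ ++ (v₀ ++ t₀)) →
      Reducible (.node () (.node () A B) C) (u ++ (v ++ t)) ∧
        Reducible (.node () A (.node () B C)) (u ++ (v ++ t)) := by
    intro A₀ B₀ C₀ u₀ v₀ t₀ hA hB hC eu ev et c₁ c₂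
    have := step_pivot hA hB hC (by rwa [eu, ev]) (by rwa [eu, et])
    rw [List.append_assoc, List.append_assoc] at c₁
    exact ⟨⟨_, _, c₁, _, .inl this⟩, ⟨_, _, c₂, _, .inr this⟩⟩
  by_cases hu : 2 ≤ u.length
  · obtain ⟨A₀, u₀, c, hA₀⟩ := hA.exists_contracts hu
    exact key A₀ B C u₀ v t hA₀ hB hC c.sum_eq rfl rfl ((c.node_left lB).node_left lC)
      (c.node_left (by simp [lB, lC, BinaryTree.numLeaves]))
  by_cases hv : 2 ≤ v.length
  · obtain ⟨B₀, v₀, c, hB₀⟩ := hB.exists_contracts hv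
    exact key A B₀ C u v₀ t hA hB₀ hC rfl c.sum_eq rfl ((c.node_right lA).node_left lC)
      ((c.node_left lC).node_right lA)
  · obtain ⟨C₀, t₀, c, hC₀⟩ := hC.exists_contracts (by simp at h; omega)
    exact key A B C₀ u v t₀ hA hB hC₀ rfl rfl c.sum_eq
      (c.node_right (by simp [lA, lB, BinaryTree.numLeaves])) ((c.node_right lB).node_right lA)

/-! ### Where a valid rotation can take place, and trees with at most three leaves -/

theorem HasEdge.node_cases {L R : Tree} {w : List Color} (h : HasEdge (.node () L R) w) :
    ∃ u v, w = u ++ v ∧ ValidFor L u ∧ ValidFor R v ∧ u.sum ≠ v.sum ∧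
      (HasEdge L u ∨ HasEdge R v ∨
        (∃ A B u₁ u₂, L = .node () A B ∧ u = u₁ ++ u₂ ∧ ValidFor A u₁ ∧ ValidFor B u₂ ∧
          u₁.sum ≠ u₂.sum ∧ u₁.sum = v.sum) ∨
        ∃ B C v₁ v₂, R = .node () B C ∧ v = v₁ ++ v₂ ∧ ValidFor B v₁ ∧ ValidFor C v₂ ∧
          u.sum ≠ v₁.sum ∧ u.sum = v₂.sum) := by
  obtain ⟨u, v, rfl, hL, hR, hne⟩ := h.validFor
  refine ⟨u, v, rfl, hL, hR, hne, ?_⟩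
  obtain ⟨S, ⟨-, hS, hr⟩ | ⟨hS, -, hr⟩⟩ := h
  · cases hr with
    | pivot A B C =>
      obtain ⟨u₁, u₂, rfl, hA, hB, h₁⟩ := hL
      rw [List.append_assoc] at hS
      obtain ⟨-, hS, -⟩ := hS.node_inv hA.length_eq
      obtain ⟨-, -, h₂⟩ := hS.node_inv hB.length_eq
      exact .inr (.inr (.inl ⟨A, B, u₁, u₂, rfl, rfl, hA, hB, h₁, sum_eq_of_pivot h₁
        (by rwa [List.sum_append] at hne) h₂ hA.sum_ne_zero hB.sum_ne_zero hR.sum_ne_zero⟩))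
    | left _ h => exact .inl ⟨_, .inl ⟨hL, (hS.node_inv (by rw [hL.length_eq, h.numLeaves_eq])).1, h⟩⟩
    | right _ h => exact .inr (.inl ⟨_, .inl ⟨hR, (hS.node_inv hL.length_eq).2.1, h⟩⟩)
  · cases hr with
    | pivot A B C =>
      obtain ⟨v₁, v₂, rfl, hB, hC, h₁⟩ := hR
      rw [← List.append_assoc] at hS
      obtain ⟨hS, -, h₃⟩ := hS.node_inv (by simp [hL.length_eq, hB.length_eq, BinaryTree.numLeaves])
      obtain ⟨-, -, h₂⟩ := hS.node_inv hL.length_eq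
      exact .inr (.inr (.inr ⟨B, C, v₁, v₂, rfl, rfl, hB, hC, h₂, sum_eq_of_pivot h₂
        (by rwa [List.sum_append] at h₃) h₁ hL.sum_ne_zero hB.sum_ne_zero hC.sum_ne_zero⟩))
    | left _ h => exact .inl ⟨_, .inr ⟨(hS.node_inv (by rw [hL.length_eq, h.numLeaves_eq])).1, hL, h⟩⟩
    | right _ h => exact .inr (.inl ⟨_, .inr ⟨(hS.node_inv hL.length_eq).2.1, hR, h⟩⟩)

theorem ValidFor.eq_nil {T : Tree} {w : List Color} (h : ValidFor T w) (hw : w.length ≤ 1) :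
    T = .nil ∧ ∃ a, a ≠ 0 ∧ w = [a] := by
  cases T with
  | nil => exact ⟨rfl, h⟩
  | node _ L R =>
    have := h.length_eq
    have := BinaryTree.numLeaves_pos L
    have := BinaryTree.numLeaves_pos R
    simp only [BinaryTree.numLeaves] at *
    omega

theorem ValidFor.length_pos {T : Tree} {w : List Color} (h : ValidFor T w) : 0 < w.length := by
  rw [h.length_eq]; exact BinaryTree.numLeaves_pos T

theorem ValidFor.eq_cherry {T : Tree} {w : List Color} (h : ValidFor T w) (hw : w.length = 2) :
    T = cherry := by
  cases T with
  | nil => obtain ⟨a, -, rfl⟩ := h; simp at hw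
  | node _ L R =>
    obtain ⟨u, v, rfl, hL, hR, -⟩ := h
    have h₁ := hL.length_pos
    have h₂ := hR.length_pos
    rw [List.length_append] at hw
    rw [(hL.eq_nil (by omega)).1, (hR.eq_nil (by omega)).1]
    rfl

theorem ValidFor.eq_of_length_eq_three {T : Tree} {w : List Color} (h : ValidFor T w)
    (hw : w.length = 3) : T = .node () cherry .nil ∨ T = .node () .nil cherry := by
  cases T with
  | nil => obtain ⟨a, -, rfl⟩ := h; simp at hw
  | node _ L R =>
    obtain ⟨u, v, rfl, hL, hR, -⟩ := h
    have h₁ := hL.length_pos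
    have h₂ := hR.length_pos
    rw [List.length_append] at hw
    by_cases hu : u.length = 1
    · right
      rw [(hL.eq_nil (by omega)).1, hR.eq_cherry (by omega)]
    · left
      rw [hL.eq_cherry (by omega), (hR.eq_nil (by omega)).1]

/-- A valid rotation between trees with at most three leaves is the only one there is. -/
theorem HasEdge.of_length_le_three {T : Tree} {w : List Color} (h : HasEdge T w)
    (hw : w.length ≤ 3) : ∃ x y, x ≠ 0 ∧ y ≠ 0 ∧ x ≠ y ∧ w = [x, y, x] ∧
      (T = .node () cherry .nil ∨ T = .node () .nil cherry) := by
  cases T with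
  | nil => obtain ⟨S, ⟨-, -, h⟩ | ⟨-, -, h⟩⟩ := h <;> cases h
  | node _ L R =>
    have small : ∀ {T : Tree} {w : List Color}, HasEdge T w → ¬ w.length ≤ 2 := by
      intro T w h hw
      refine h.not_rigid ?_
      obtain ⟨S, h⟩ := h
      have hS : ValidFor T w ∧ ValidFor S w := by
        rcases h with h | h
        exacts [⟨h.1, h.2.1⟩, ⟨h.2.1, h.1⟩]
      have hT := hS.1
      by_cases h' : w.length ≤ 1
      · obtain ⟨-, a, -, rfl⟩ := hT.eq_nil h'
        exact ⟨[(a, true)], rfl, by simp⟩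
      · obtain rfl := hT.eq_cherry (by omega)
        obtain ⟨u, v, rfl, ⟨a, ha, rfl⟩, ⟨b, hb, rfl⟩, hab⟩ := hT
        have hab : a ≠ b := by simpa using hab
        have key : ∀ a b : Color, a ≠ 0 ∧ b ≠ 0 ∧ a ≠ b → ∃ s, Follows (a, s) (b, s) := by decide
        obtain ⟨s, hs⟩ := key a b ⟨ha, hb, hab⟩
        exact ⟨[(a, s), (b, s)], rfl, by simpa using hs⟩
    obtain ⟨u, v, rfl, hL, hR, hne, h | h | h | h⟩ := h.node_cases
    · have := small h
      have := hR.length_pos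
      simp at hw; omega
    · have := small h
      have := hL.length_pos
      simp at hw; omega
    · obtain ⟨A, B, u₁, u₂, rfl, rfl, hA, hB, h₁, h₂⟩ := h
      have := hA.length_pos
      have := hB.length_pos
      have := hR.length_pos
      simp only [List.length_append] at hw
      obtain ⟨rfl, a, ha, rfl⟩ := hA.eq_nil (by omega)
      obtain ⟨rfl, b, hb, rfl⟩ := hB.eq_nil (by omega)
      obtain ⟨rfl, c, hc, rfl⟩ := hR.eq_nil (by omega)
      simp only [List.sum_singleton] at h₁ h₂
      exact ⟨a, b, ha, hb, h₁, by simp [h₂], .inl rfl⟩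
    · obtain ⟨B, C, v₁, v₂, rfl, rfl, hB, hC, h₁, h₂⟩ := h
      have := hB.length_pos
      have := hC.length_pos
      have := hL.length_pos
      simp only [List.length_append] at hw
      obtain ⟨rfl, a, ha, rfl⟩ := hL.eq_nil (by omega)
      obtain ⟨rfl, b, hb, rfl⟩ := hB.eq_nil (by omega)
      obtain ⟨rfl, c, hc, rfl⟩ := hC.eq_nil (by omega)
      simp only [List.sum_singleton] at h₁ h₂
      exact ⟨a, b, ha, hb, h₁, by simp [h₂], .inr rfl⟩

theorem step_three {x y : Color} (hx : x ≠ 0) (hy : y ≠ 0) (h : x ≠ y) :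
    Step [x, y, x] (.node () cherry .nil) (.node () .nil cherry) :=
  step_pivot (validFor_nil hx) (validFor_nil hy) (validFor_nil hx) (by simpa using h) rfl

theorem contracts_cherry {x y : Color} (h : x ≠ y) : Contracts cherry [x, y] .nil [x + y] :=
  ⟨rfl, [], x, y, [], rfl, rfl, h, rfl⟩

theorem eq_or_eq_add {x y c : Color} (hx : x ≠ 0) (hy : y ≠ 0) (hc : c ≠ 0) (h : x ≠ y)
    (hcy : c ≠ y) : c = x ∨ c = x + y := by
  have key : ∀ x y c : Color, x ≠ 0 ∧ y ≠ 0 ∧ c ≠ 0 ∧ x ≠ y ∧ c ≠ y → c = x ∨ c = x + y := by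
    decide
  exact key x y c ⟨hx, hy, hc, h, hcy⟩

/-- A cherry disjoint from the rotation, or inside one of its three subtrees, can be contracted at
once. The exception is a three-leaf tree on `x, y, x` beside a single leaf, where the only cherry
takes part in the rotation; there it may be necessary to rotate first. -/
theorem HasEdge.exists_reducible {T : Tree} {w : List Color} (h : HasEdge T w)
    (hw : 4 ≤ w.length) : ∃ S, Conn w T S ∧ Reducible S w := by
  induction T generalizing w with
  | nil => obtain ⟨S, ⟨-, -, h⟩ | ⟨-, -, h⟩⟩ := h <;> cases h
  | node _ L R ihL ihR =>
    obtain ⟨u, v, rfl, hL, hR, hne, h | h | h | h⟩ := h.node_cases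
    · by_cases hu : 4 ≤ u.length
      · obtain ⟨S, hc, hS⟩ := ihL h hu
        exact ⟨_, hc.map (fun L => .node () L R) fun _ _ h => h.node_left hR hne,
          hS.node_left hR hne⟩
      by_cases hv : 2 ≤ v.length
      · obtain ⟨R₀, v₀, c, hR₀⟩ := hR.exists_contracts hv
        exact ⟨_, .refl _, _, _, c.node_right hL.length_eq,
          h.node_left hR₀ (by rwa [c.sum_eq])⟩
      obtain ⟨x, y, hx, hy, hxy, rfl, hL'⟩ := h.of_length_le_three (by omega)
      obtain ⟨rfl, c, hc, rfl⟩ := hR.eq_nil (by omega)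
      have hz : x + y ≠ 0 := (add_ne_zero_iff_ne _ _).2 hxy
      have hstep : Step [x, y, x, c] _ _ := (step_three hx hy hxy).node_left hR hne
      have hcy : c ≠ y := by
        rintro rfl
        apply hne
        simp only [List.sum_cons, List.sum_nil]
        clear * -; revert x c; decide
      have hconn : ∀ S, S = .node () (.node () cherry .nil) .nil ∨
          S = .node () (.node () .nil cherry) .nil → Conn [x, y, x, c] (.node () L .nil) S := by
        rintro S (rfl | rfl) <;> rcases hL' with rfl | rfl
        exacts [.refl _, hstep.conn.symm, hstep.conn, .refl _]
      rcases eq_or_eq_add hx hy hc hxy hcy with rfl | rfl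
      · refine ⟨_, hconn _ (.inr rfl), _, _, ((contracts_cherry hxy.symm).node_right
          (L := .nil) (u := [c]) rfl).node_left (R := .nil) (v := [c]) rfl, ?_⟩
        rw [add_comm y]
        exact ⟨_, .inl (step_three hx hz (by simpa using hy))⟩
      · exact ⟨_, hconn _ (.inl rfl), _, _, ((contracts_cherry hxy).node_left
          (R := .nil) (v := [x]) rfl).node_left (R := .nil) (v := [x + y]) rfl, _,
          .inl (step_three hz hx (by simpa using hy))⟩
    · by_cases hv : 4 ≤ v.length
      · obtain ⟨S, hc, hS⟩ := ihR h hv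
        exact ⟨_, hc.map (fun R => .node () L R) fun _ _ h => h.node_right hL hne,
          hS.node_right hL hne⟩
      by_cases hu : 2 ≤ u.length
      · obtain ⟨L₀, u₀, c, hL₀⟩ := hL.exists_contracts hu
        exact ⟨_, .refl _, _, _, c.node_left hR.length_eq,
          h.node_right hL₀ (by rwa [c.sum_eq])⟩
      obtain ⟨x, y, hx, hy, hxy, rfl, hR'⟩ := h.of_length_le_three (by omega)
      obtain ⟨rfl, c, hc, rfl⟩ := hL.eq_nil (by omega)
      have hz : x + y ≠ 0 := (add_ne_zero_iff_ne _ _).2 hxy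
      have hstep : Step [c, x, y, x] _ _ := (step_three hx hy hxy).node_right hL hne
      have hcy : c ≠ y := by
        rintro rfl
        apply hne
        simp only [List.sum_cons, List.sum_nil]
        clear * -; revert x c; decide
      have hconn : ∀ S, S = .node () .nil (.node () cherry .nil) ∨
          S = .node () .nil (.node () .nil cherry) → Conn [c, x, y, x] (.node () .nil R) S := by
        rintro S (rfl | rfl) <;> rcases hR' with rfl | rfl
        exacts [.refl _, hstep.conn.symm, hstep.conn, .refl _]
      rcases eq_or_eq_add hx hy hc hxy hcy with rfl | rfl
      · exact ⟨_, hconn _ (.inl rfl), _, _, ((contracts_cherry hxy).node_left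
          (R := .nil) (v := [c]) rfl).node_right (L := .nil) (u := [c]) rfl, _,
          .inr (step_three hx hz (by simpa using hy))⟩
      · refine ⟨_, hconn _ (.inr rfl), _, _, ((contracts_cherry hxy.symm).node_right
          (L := .nil) (u := [x]) rfl).node_right (L := .nil) (u := [x + y]) rfl, ?_⟩
        rw [add_comm y]
        exact ⟨_, .inr (step_three hz hx (by simpa using hy))⟩
    · obtain ⟨A, B, u₁, u₂, rfl, rfl, hA, hB, h₁, h₂⟩ := h
      rw [List.append_assoc] at hw ⊢
      exact ⟨_, .refl _, (reducible_pivot hA hB hR h₁ h₂ hw).1⟩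
    · obtain ⟨B, C, v₁, v₂, rfl, rfl, hB, hC, h₁, h₂⟩ := h
      exact ⟨_, .refl _, (reducible_pivot hL hB hC h₁ h₂ hw).2⟩

/-! ### A criterion for rigidity of words -/

/-- The states that a letter may have to the left of `x, y, x + y` (with orders `σ`) if the letters
from it up to `x` (exclusive) have sum `s`. -/
def LeftInv (x y : Color) (σ : Bool) (s : Color) (a : Color × Bool) : Prop :=
  (s = 0 ∧ (a = (x, σ) ∨ a = (x + y, !σ))) ∨ (s = x ∧ (a = (x, !σ) ∨ a = (y, σ))) ∨
    (s = x + y ∧ (a = (x + y, σ) ∨ a = (y, !σ)))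

/-- The states that a letter may have to the right of `x, y, x + y` (with orders `σ`) if the letters
from `x + y` (exclusive) up to it have sum `s`. -/
def RightInv (x y : Color) (σ : Bool) (s : Color) (a : Color × Bool) : Prop :=
  (s = 0 ∧ (a = (x + y, σ) ∨ a = (x, !σ))) ∨ (s = x + y ∧ (a = (x + y, !σ) ∨ a = (y, σ))) ∨
    (s = x ∧ (a = (x, σ) ∨ a = (y, !σ)))

instance (x y : Color) (σ : Bool) (s : Color) (a : Color × Bool) :
    Decidable (LeftInv x y σ s a) := by
  unfold LeftInv; infer_instance

instance (x y : Color) (σ : Bool) (s : Color) (a : Color × Bool) :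
    Decidable (RightInv x y σ s a) := by
  unfold RightInv; infer_instance

set_option synthInstance.maxSize 1000 in
-- For each partial sum other than `y` exactly two states are listed, and from each of them every
-- permitted letter has a suitable order. The partial sum `y` is the only obstruction to extending
-- the chain.
theorem LeftInv.step {x y : Color} {σ : Bool} {s c : Color} {a : Color × Bool}
    (hx : x ≠ 0) (hxy : Follows (x, σ) (y, σ)) (h : LeftInv x y σ s a) (hc : c ≠ 0)
    (hs : c + s ≠ y) : ∃ τ, Follows (c, τ) a ∧ LeftInv x y σ (c + s) (c, τ) := by
  -- Since `y` is determined by `x` and `σ`, the finite check needs one variable less.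
  obtain rfl : y = turn (!σ) x := by simpa [Follows] using hxy
  have key : ∀ (x : Color) (σ : Bool) (s : Color) (a : Color × Bool),
      x ≠ 0 ∧ LeftInv x (turn (!σ) x) σ s a → ∀ c, c ≠ 0 ∧ c + s ≠ turn (!σ) x →
      ∃ τ, Follows (c, τ) a ∧ LeftInv x (turn (!σ) x) σ (c + s) (c, τ) := by
    decide
  exact key x σ s a ⟨hx, h⟩ c ⟨hc, hs⟩

set_option synthInstance.maxSize 1000 in
theorem RightInv.step {x y : Color} {σ : Bool} {s c : Color} {a : Color × Bool}
    (hx : x ≠ 0) (hxy : Follows (x, σ) (y, σ)) (h : RightInv x y σ s a) (hc : c ≠ 0)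
    (hs : s + c ≠ y) : ∃ τ, Follows a (c, τ) ∧ RightInv x y σ (s + c) (c, τ) := by
  obtain rfl : y = turn (!σ) x := by simpa [Follows] using hxy
  have key : ∀ (x : Color) (σ : Bool) (s : Color) (a : Color × Bool),
      x ≠ 0 ∧ RightInv x (turn (!σ) x) σ s a → ∀ c, c ≠ 0 ∧ s + c ≠ turn (!σ) x →
      ∃ τ, Follows a (c, τ) ∧ RightInv x (turn (!σ) x) σ (s + c) (c, τ) := by
    decide
  exact key x σ s a ⟨hx, h⟩ c ⟨hc, hs⟩

theorem exists_chain_left {x y : Color} {σ : Bool} (hx : x ≠ 0) (hxy : Follows (x, σ) (y, σ))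
    {p : List Color} (hp : ∀ c ∈ p, c ≠ 0) (hs : ∀ u, u <:+ p → u.sum ≠ y) :
    ∃ l : List (Color × Bool), l.map Prod.fst = p ∧ (l ++ [(x, σ)]).IsChain Follows ∧
      ∀ a ∈ (l ++ [(x, σ)]).head?, LeftInv x y σ p.sum a := by
  induction p with
  | nil => exact ⟨[], rfl, by simp, by simp [LeftInv]⟩
  | cons c p ih =>
    obtain ⟨l, rfl, hl, hi⟩ := ih (fun d hd => hp d (by simp [hd]))
      (fun u hu => hs u (hu.trans (List.suffix_cons _ _)))
    have hne : l ++ [(x, σ)] ≠ [] := by simp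
    obtain ⟨τ, h₁, h₂⟩ := (hi _ (List.head?_eq_some_head hne)).step hx hxy (hp c (by simp))
      (by simpa using hs _ (List.suffix_refl _))
    refine ⟨(c, τ) :: l, rfl, ?_, by simpa using h₂⟩
    rw [List.cons_append, List.isChain_cons]
    refine ⟨fun b hb => ?_, hl⟩
    rw [List.head?_eq_some_head hne] at hb
    cases hb
    exact h₁

theorem exists_chain_right {x y : Color} {σ : Bool} (hx : x ≠ 0)
    (hxy : Follows (x, σ) (y, σ)) {q : List Color} (hq : ∀ c ∈ q, c ≠ 0) {s : Color}
    {a : Color × Bool} (ha : RightInv x y σ s a) (hs : ∀ u, u <+: q → s + u.sum ≠ y) :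
    ∃ l : List (Color × Bool), l.map Prod.fst = q ∧ (a :: l).IsChain Follows := by
  induction q generalizing s a with
  | nil => exact ⟨[], rfl, by simp⟩
  | cons c q ih =>
    obtain ⟨τ, h₁, h₂⟩ := ha.step hx hxy (hq c (by simp)) (by simpa using hs [c] (by simp))
    obtain ⟨l, rfl, hl⟩ := ih (fun d hd => hq d (by simp [hd])) h₂ (fun u hu => by
      have := hs (c :: u) (by simpa using hu)
      rwa [List.sum_cons, ← add_assoc] at this)
    exact ⟨(c, τ) :: l, rfl, by simpa using ⟨h₁, hl⟩⟩

/-- The letters `x, y, x + y` form a chain with one common order, and the two invariants extend it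
outwards letter by letter. -/
theorem rigid_of_forall_sum_ne {x y : Color} {p q : List Color} (hx : x ≠ 0) (hy : y ≠ 0)
    (hxy : x ≠ y) (hp : ∀ c ∈ p, c ≠ 0) (hq : ∀ c ∈ q, c ≠ 0) (hps : ∀ u, u <:+ p → u.sum ≠ y)
    (hqs : ∀ u, u <+: q → u.sum ≠ y) : Rigid (p ++ x :: y :: (x + y) :: q) := by
  obtain ⟨σ, h₁, h₂⟩ : ∃ σ, Follows (x, σ) (y, σ) ∧ Follows (y, σ) (x + y, σ) := by
    have key : ∀ x y : Color, x ≠ 0 ∧ y ≠ 0 ∧ x ≠ y →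
        ∃ σ, Follows (x, σ) (y, σ) ∧ Follows (y, σ) (x + y, σ) := by decide
    exact key x y ⟨hx, hy, hxy⟩
  obtain ⟨l₁, rfl, c₁, -⟩ := exists_chain_left hx h₁ hp hps
  obtain ⟨l₂, rfl, c₂⟩ := exists_chain_right (s := 0) (a := (x + y, σ)) hx h₁ hq
    (.inl ⟨rfl, .inl rfl⟩) (by simpa using hqs)
  refine ⟨(l₁ ++ [(x, σ)]) ++ (y, σ) :: (x + y, σ) :: l₂, by simp, ?_⟩
  rw [List.isChain_append]
  refine ⟨c₁, ?_, ?_⟩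
  · rw [List.isChain_cons_cons]
    exact ⟨h₂, c₂⟩
  · simpa using h₁

theorem sum_eq_of_forall_eq {z : Color} {u : List Color} (h : ∀ c ∈ u, c = z) :
    u.sum = 0 ∨ u.sum = z := by
  induction u with
  | nil => simp
  | cons c u ih =>
    obtain rfl := h c (by simp)
    rw [List.sum_cons]
    rcases ih fun d hd => h d (by simp [hd]) with h | h <;> rw [h]
    · simp
    · left; clear * -; revert c; decide

/-- Partial sums of letters `x + y` are `0` or `x + y`, so they avoid the middle letter of a triple
formed by `x`, `y` and an adjacent `x + y`. -/
theorem rigid_of_forall_eq {x y : Color} {p q : List Color} (hx : x ≠ 0) (hy : y ≠ 0)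
    (hxy : x ≠ y) (hp : ∀ c ∈ p, c = x + y) (hq : ∀ c ∈ q, c = x + y) (h : p ≠ [] ∨ q ≠ []) :
    Rigid (p ++ x :: y :: q) := by
  have hz : x + y ≠ 0 := (add_ne_zero_iff_ne _ _).2 hxy
  have hsum : ∀ u : List Color, (∀ c ∈ u, c = x + y) → u.sum ≠ x ∧ u.sum ≠ y := by
    intro u hu
    rcases sum_eq_of_forall_eq hu with h | h <;> rw [h]
    · exact ⟨hx.symm, hy.symm⟩
    · exact ⟨by simpa using hy, by simpa using hx⟩
  by_cases hq' : q = []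
  · have hp' : p ≠ [] := by simpa [hq'] using h
    obtain ⟨p', z, rfl⟩ := List.eq_nil_or_concat p |>.resolve_left hp'
    rw [List.concat_eq_append] at *
    obtain rfl := hp z (by simp)
    have hp'' : ∀ c ∈ p', c = x + y := fun c hc => hp c (by simp [hc])
    have := rigid_of_forall_sum_ne (p := p') (q := q) hz hx (by simpa using hy)
      (fun c hc => by rwa [hp'' c hc]) (fun c hc => by rwa [hq c hc])
      (fun u hu => (hsum u fun c hc => hp'' c (hu.subset hc)).1)
      (fun u hu => (hsum u fun c hc => hq c (hu.subset hc)).1)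
    -- The triple is `x + y, x, y` here, so its third letter appears as the sum of the first two.
    rw [show x + y + x = y by clear * -; revert x y; decide] at this
    simpa using this
  · obtain ⟨z, q', rfl⟩ := List.exists_cons_of_ne_nil hq'
    obtain rfl := hq z (by simp)
    have hq'' : ∀ c ∈ q', c = x + y := fun c hc => hq c (by simp [hc])
    exact rigid_of_forall_sum_ne hx hy hxy (fun c hc => by rwa [hp c hc])
      (fun c hc => by rwa [hq'' c hc])
      (fun u hu => (hsum u fun c hc => hp c (hu.subset hc)).2)
      (fun u hu => (hsum u fun c hc => hq'' c (hu.subset hc)).2)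

/-- Two consecutive leaf edges of different colors must have the same order, and continuing in that
order leads to the third color or repeats `y`, never back to `x`. -/
theorem not_rigid_of_alternating {x y : Color} {p q : List Color} (hx : x ≠ 0) (hy : y ≠ 0)
    (hxy : x ≠ y) : ¬ Rigid (p ++ x :: y :: x :: q) := by
  rintro ⟨l, e, c⟩
  obtain ⟨l₁, l₂, rfl, -, e⟩ := List.map_eq_append_iff.1 e
  obtain ⟨a, l₃, rfl, rfl, e₁⟩ := List.map_eq_cons_iff.1 e
  obtain ⟨b, l₄, rfl, rfl, e₂⟩ := List.map_eq_cons_iff.1 e₁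
  obtain ⟨d, l₅, rfl, hd, -⟩ := List.map_eq_cons_iff.1 e₂
  have c := (List.isChain_append.1 c).2.1
  rw [List.isChain_cons_cons, List.isChain_cons_cons] at c
  obtain ⟨c₁, c₂, -⟩ := c
  have key : ∀ a b : Color × Bool, ∀ s, (a.1 ≠ 0 ∧ b.1 ≠ 0 ∧ a.1 ≠ b.1) ∧
      Follows a b → ¬ Follows b (a.1, s) := by decide
  refine key a b d.2 ⟨⟨hx, hy, hxy⟩, c₁⟩ ?_
  rwa [← hd]

/-! ### Linking the classes of trees with a given pair of sibling leaves -/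

/-- The trees valid for `p ++ x :: y :: q` in which the leaves of `x` and `y` are siblings. -/
def siblingClass (p : List Color) (x y : Color) (q : List Color) : Set Tree :=
  {S | ∃ T, ValidFor T (p ++ (x + y) :: q) ∧ S = graft cherry T p.length}

/-- Any two trees valid for `w` are connected by rotations between valid trees. -/
def AllConn (w : List Color) : Prop := ∀ T S, ValidFor T w → ValidFor S w → Conn w T S

/-- Grafting a cherry carries a path of trees for the contracted word to a path inside the class. -/
theorem AllConn.conn_of_mem {p q : List Color} {x y : Color} {T S : Tree}
    (h : AllConn (p ++ (x + y) :: q)) (hx : x ≠ 0) (hy : y ≠ 0) (hxy : x ≠ y)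
    (hT : T ∈ siblingClass p x y q) (hS : S ∈ siblingClass p x y q) :
    Conn (p ++ x :: y :: q) T S := by
  obtain ⟨T, hT, rfl⟩ := hT
  obtain ⟨S, hS, rfl⟩ := hS
  exact (h T S hT hS).map _ fun _ _ h => h.graft_cherry hx hy hxy

theorem numLeaves_cherry : cherry.numLeaves = 2 := rfl

/-- Grafting both cherries onto a tree for the doubly contracted word gives a common member, since
grafts at different leaves commute. -/
theorem exists_mem_inter {p m q : List Color} {x y x' y' : Color} (hx : x ≠ 0) (hy : y ≠ 0)
    (hxy : x ≠ y) (hx' : x' ≠ 0) (hy' : y' ≠ 0) (hxy' : x' ≠ y')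
    (h : ∃ T, ValidFor T (p ++ (x + y) :: (m ++ (x' + y') :: q))) :
    ∃ T, T ∈ siblingClass p x y (m ++ x' :: y' :: q) ∧
      T ∈ siblingClass (p ++ x :: y :: m) x' y' q := by
  obtain ⟨T, hT⟩ := h
  have hT' : ValidFor T ((p ++ (x + y) :: m) ++ (x' + y') :: q) := by simpa using hT
  have hl : (p ++ (x + y) :: m).length < T.numLeaves := by
    rw [← hT'.length_eq]; simp
  refine ⟨graft cherry (graft cherry T (p ++ (x + y) :: m).length) p.length,
    ⟨_, ?_, rfl⟩, graft cherry T p.length, ?_, ?_⟩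
  · simpa using hT'.graft_cherry hx' hy' hxy'
  · simpa using hT.graft_cherry hx hy hxy
  · rw [graft_graft_comm (by simp) hl, numLeaves_cherry]
    congr 1
    simp [add_assoc]

/-- Two neighboring classes that meet in a word `x, y, x`. -/
theorem link_of_alternating {p q : List Color} {x y : Color} (hx : x ≠ 0) (hy : y ≠ 0)
    (hxy : x ≠ y) (h : ∃ T, ValidFor T (p ++ y :: q)) :
    ∃ T ∈ siblingClass p x y (x :: q), ∃ S ∈ siblingClass (p ++ [x]) y x q,
      Conn (p ++ x :: y :: x :: q) T S := by
  obtain ⟨T, hT⟩ := h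
  have hz : x + y ≠ 0 := (add_ne_zero_iff_ne _ _).2 hxy
  have hp : p.length < T.numLeaves := by rw [← hT.length_eq]; simp
  have e₁ : x + y + x = y := by clear * -; revert x y; decide
  have e₂ : x + (y + x) = y := by clear * -; revert x y; decide
  -- The three leaves `x, y, x` have total color `y`, so both bracketings fit at a leaf of color
  -- `y`.
  refine ⟨graft (.node () cherry .nil) T p.length, ⟨graft cherry T p.length, ?_, ?_⟩,
    graft (.node () .nil cherry) T p.length, ⟨graft cherry T p.length, ?_, ?_⟩, ?_⟩
  · rw [← e₁] at hT
    exact hT.graft_cherry hz hx (by simpa using hy)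
  · exact (graft_graft_inside (U := cherry) (V := cherry) (k := 0) hp (by decide)).symm
  · rw [← e₂] at hT
    simpa using hT.graft_cherry hx (by rwa [add_comm]) (by simpa using hy)
  · rw [List.length_append]
    exact (graft_graft_inside (U := cherry) (V := cherry) (k := 1) hp (by decide)).symm
  · exact (Step.graft_of_step hT (step_three hx hy hxy)
      (by simp only [List.sum_cons, List.sum_nil, add_zero]; exact e₂)).conn

theorem add_add_self_right (x y : Color) : y + x + x = y := by
  revert x y; decide

theorem add_self_eq_zero (x : Color) : x + x = 0 := by
  revert x; decide

/-- Two neighboring classes that meet in a word `x, y, x + y` that is preceded by a subtree of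
color `y`. -/
theorem link_of_suffix {p u q : List Color} {x y : Color} (hx : x ≠ 0) (hy : y ≠ 0)
    (hxy : x ≠ y) {L : Tree} (hL : ValidFor L u) (hu : u.sum = y)
    (h : ∃ T, ValidFor T (p ++ y :: q)) :
    ∃ T ∈ siblingClass (p ++ u) x y ((x + y) :: q),
    ∃ S ∈ siblingClass (p ++ u ++ [x]) y (x + y) q,
      Conn (p ++ u ++ x :: y :: (x + y) :: q) T S := by
  obtain ⟨T, hT⟩ := h
  have hz : x + y ≠ 0 := (add_ne_zero_iff_ne _ _).2 hxy
  have hp : p.length < T.numLeaves := by rw [← hT.length_eq]; simp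
  have hl := hL.length_eq
  have e₁ : y + (x + y) = x := by clear * -; revert x y; decide
  have vx := validFor_nil hx
  have vy := validFor_nil hy
  have vz := validFor_nil hz
  have hyz : y ≠ x + y := by simpa using hx
  have hxz : x ≠ x + y := by simpa using hy
  have hLx : ValidFor (.node () L .nil) (u ++ [x]) :=
    validFor_node hL vx (by simpa [hu] using hxy.symm)
  have hLz : ValidFor (.node () L .nil) (u ++ [x + y]) :=
    validFor_node hL vz (by simpa only [List.sum_singleton, hu] using hyz)
  -- `U` is the common shape of both contractions: its last two leaves carry `x + y, x + y` after
  -- merging `x, y`, and `x, x` after merging `y, x + y`.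
  let U : Tree := .node () (.node () L .nil) .nil
  have hU : U.numLeaves = u.length + 2 := by simp [U, BinaryTree.numLeaves, hl]
  have hU₁ : ValidFor U (u ++ [x + y] ++ [x + y]) := validFor_node hLz vz
    (by simpa only [List.sum_append, List.sum_singleton, hu, e₁] using hxz)
  have hU₂ : ValidFor U (u ++ [x] ++ [x]) := validFor_node hLx vx
    (by simpa only [List.sum_append, List.sum_singleton, hu, add_comm y] using hxz.symm)
  -- The fully left-bracketed tree is the midpoint. One rotation uses the outer colors `y, y` of `L`
  -- and the leaf `y`; the other, below, uses the outer colors `x + y, x + y` of `L x` and the last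
  -- leaf.
  have s₁ : Step (u ++ ([x] ++ [y]) ++ [x + y])
      (.node () (.node () (.node () L .nil) .nil) .nil)
      (.node () (.node () L cherry) .nil) :=
    (step_pivot hL vx vy (by simpa [hu] using hxy.symm) (by simp [hu])).node_left vz
      (by simpa only [List.sum_append, List.sum_singleton, hu, e₁] using hxz)
  have s₂ : Step (u ++ [x] ++ ([y] ++ [x + y]))
      (.node () (.node () (.node () L .nil) .nil) .nil)
      (.node () (.node () L .nil) cherry) :=
    step_pivot hLx vy vz
      (by simpa only [List.sum_append, List.sum_singleton, hu, add_comm y] using hyz.symm)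
      (by simp only [List.sum_append, List.sum_singleton, hu, add_comm y])
  refine ⟨graft (.node () (.node () L cherry) .nil) T p.length, ⟨graft U T p.length, ?_, ?_⟩,
    graft (.node () (.node () L .nil) cherry) T p.length, ⟨graft U T p.length, ?_, ?_⟩,
    Conn.trans (S := graft (.node () (.node () (.node () L .nil) .nil) .nil) T p.length)
      (Step.conn ?_).symm (Step.conn ?_)⟩
  · simpa using hT.graft hU₁ (by
      simp only [List.sum_append, List.sum_singleton, hu, add_add_self_right])
  · rw [List.length_append, graft_graft_inside hp (by omega)]
    congr 1
    rw [graft_node_left (by simp [BinaryTree.numLeaves, hl]), hl]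
    exact congrArg (fun X => BinaryTree.node () X .nil)
      (graft_node_right (U := cherry) (R := .nil) (i := 0)).symm
  · rw [e₁]
    simpa using hT.graft hU₂ (by
      simp only [List.sum_append, List.sum_singleton, hu, add_add_self_right])
  · rw [List.length_append, List.length_append, add_assoc, graft_graft_inside hp (by simp; omega)]
    congr 1
    rw [hl]
    exact (graft_node_right (U := cherry) (L := .node () L .nil) (R := .nil) (i := 0)).symm
  · simpa using Step.graft_of_step hT s₁ (by
      simp only [List.sum_append, List.sum_singleton, hu]
      clear * -; revert x y; decide)
  · simpa using Step.graft_of_step hT s₂ (by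
      simp only [List.sum_append, List.sum_singleton, hu, e₁, add_add_self_right])

/-- Two neighboring classes that meet in a word `x, y, x + y` that is followed by a subtree of
color `y`. -/
theorem link_of_prefix {p v q : List Color} {x y : Color} (hx : x ≠ 0) (hy : y ≠ 0)
    (hxy : x ≠ y) {R : Tree} (hR : ValidFor R v) (hv : v.sum = y)
    (h : ∃ T, ValidFor T (p ++ y :: q)) :
    ∃ T ∈ siblingClass p x y ((x + y) :: (v ++ q)),
    ∃ S ∈ siblingClass (p ++ [x]) y (x + y) (v ++ q),
      Conn (p ++ x :: y :: (x + y) :: (v ++ q)) T S := by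
  obtain ⟨T, hT⟩ := h
  have hz : x + y ≠ 0 := (add_ne_zero_iff_ne _ _).2 hxy
  have hp : p.length < T.numLeaves := by rw [← hT.length_eq]; simp
  have e₁ : y + (x + y) = x := by clear * -; revert x y; decide
  have vx := validFor_nil hx
  have vy := validFor_nil hy
  have vz := validFor_nil hz
  have hyz : y ≠ x + y := by simpa using hx
  have hxz : x ≠ x + y := by simpa using hy
  have hxR : ValidFor (.node () .nil R) ([x] ++ v) :=
    validFor_node vx hR (by simpa [hv] using hxy)
  have hzR : ValidFor (.node () .nil R) ([x + y] ++ v) :=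
    validFor_node vz hR (by simpa only [List.sum_singleton, hv] using hyz.symm)
  -- `U` is again the shape of both contractions, now with the merged pair among its first leaves;
  -- the fully right-bracketed tree is the midpoint.
  let U : Tree := .node () .nil (.node () .nil R)
  have hU : 2 < U.numLeaves := by
    have := BinaryTree.numLeaves_pos R
    simp only [U, BinaryTree.numLeaves]
    omega
  have hU₁ : ValidFor U ([x + y] ++ ([x + y] ++ v)) := validFor_node vz hzR
    (by simpa only [List.sum_append, List.sum_singleton, hv, add_add_self_right] using hxz.symm)
  have hU₂ : ValidFor U ([x] ++ ([x] ++ v)) := validFor_node vx hxR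
    (by simpa only [List.sum_append, List.sum_singleton, hv] using hxz)
  have s₁ : Step ([x] ++ ([y] ++ ([x + y] ++ v))) (.node () cherry (.node () .nil R))
      (.node () .nil (.node () .nil (.node () .nil R))) :=
    step_pivot vx vy hzR (by simpa using hxy)
      (by simp only [List.sum_append, List.sum_singleton, hv, add_add_self_right])
  have s₂ : Step ([x] ++ ([y] ++ ([x + y] ++ v))) (.node () .nil (.node () cherry R))
      (.node () .nil (.node () .nil (.node () .nil R))) :=
    (step_pivot vy vz hR (by simpa only [List.sum_singleton] using hyz) (by simp [hv])).node_right
      vx (by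
        simpa only [List.sum_append, List.sum_singleton, hv, add_add_self_right, add_comm y]
          using hxz)
  have hsum : ([x] ++ ([y] ++ ([x + y] ++ v))).sum = y := by
    simp only [List.sum_append, List.sum_singleton, hv, add_add_self_right]
    clear * -; revert x y; decide
  refine ⟨graft (.node () cherry (.node () .nil R)) T p.length, ⟨graft U T p.length, ?_, ?_⟩,
    graft (.node () .nil (.node () cherry R)) T p.length, ⟨graft U T p.length, ?_, ?_⟩,
    Conn.trans (S := graft (.node () .nil (.node () .nil (.node () .nil R))) T p.length)
      (Step.conn ?_) (Step.conn ?_).symm⟩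
  · simpa using hT.graft hU₁ (by
      simp only [List.sum_append, List.sum_singleton, hv]
      clear * -; revert x y; decide)
  · exact (graft_graft_inside (U := U) (V := cherry) (k := 0) hp (by omega)).symm
  · rw [e₁]
    simpa using hT.graft hU₂ (by
      simp only [List.sum_append, List.sum_singleton, hv, ← add_assoc, add_self_eq_zero, zero_add])
  · rw [List.length_append]
    exact (graft_graft_inside (U := U) (V := cherry) (k := 1) hp (by omega)).symm
  · simpa using Step.graft_of_step hT s₁ hsum
  · simpa using Step.graft_of_step hT s₂ hsum

/-- Two neighboring classes that meet in a word `x, y, x + y`. -/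
theorem link_of_not_rigid {p q : List Color} {x y : Color}
    (ih : ∀ w' : List Color, w'.length < (p ++ x :: y :: (x + y) :: q).length → ¬ Rigid w' →
      AllConn w')
    (h₀ : ∀ c ∈ p ++ x :: y :: (x + y) :: q, c ≠ 0)
    (hs : (p ++ x :: y :: (x + y) :: q).sum ≠ 0)
    (hxy : x ≠ y) (hr : ¬ Rigid (p ++ x :: y :: (x + y) :: q)) :
    ∃ T ∈ siblingClass p x y ((x + y) :: q), ∃ S ∈ siblingClass (p ++ [x]) y (x + y) q,
      Conn (p ++ x :: y :: (x + y) :: q) T S := by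
  have hx : x ≠ 0 := h₀ x (by simp)
  have hy : y ≠ 0 := h₀ y (by simp)
  have hz : x + y ≠ 0 := h₀ _ (by simp)
  have hp : ∀ c ∈ p, c ≠ 0 := fun c hc => h₀ c (by simp [hc])
  have hq : ∀ c ∈ q, c ≠ 0 := fun c hc => h₀ c (by simp [hc])
  have hyz : y ≠ x + y := by simpa using hx
  have hxz : x ≠ x + y := by simpa using hy
  have e₁ : y + (x + y) = x := by clear * -; revert x y; decide
  have e₂ : x + y + y = x := by clear * -; revert x y; decide
  have e₃ : x + (y + (x + y)) = 0 := by clear * -; revert x y; decide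
  have hs' : p.sum + q.sum ≠ 0 := by
    have e : (p ++ x :: y :: (x + y) :: q).sum = p.sum + (x + (y + (x + y)) + q.sum) := by
      simp [add_assoc]
    rwa [e, e₃, zero_add] at hs
  by_cases hpy : ∃ p', p = p' ++ [y]
  -- In `y, x, y, x + y` the class of the first pair serves as a detour. It is linked to the class
  -- of `x, y` by a rotation, it meets the class of `y, x + y` because the pairs are disjoint, and
  -- it is connected because its contraction contains `x + y, y, x + y`.
  · obtain ⟨p', rfl⟩ := hpy
    obtain ⟨T, hT, S, hS, hTS⟩ := link_of_alternating (p := p') (q := (x + y) :: q) hy hx hxy.symm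
      (exists_validFor (by
          simp only [List.mem_append, List.mem_cons]
          rintro c (hc | rfl | rfl | hc)
          exacts [hp c (by simp [hc]), hx, hz, hq c hc])
        (by
          have e : (p' ++ x :: (x + y) :: q).sum = (p' ++ [y]).sum + q.sum := by
            simp only [List.sum_append, List.sum_cons, List.sum_nil, add_zero, ← add_assoc]
            rw [add_assoc _ x x, add_self_eq_zero, add_zero]
          rwa [e])
        ⟨x, by simp, x + y, by simp, hxz⟩)
    obtain ⟨S', hS₁, hS₂⟩ := exists_mem_inter (p := p') (m := []) (q := q) hy hx hxy.symm hy hz hyz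
      (exists_validFor (by
          simp only [List.nil_append, List.mem_append, List.mem_cons]
          rintro c (hc | rfl | rfl | hc)
          exacts [hp c (by simp [hc]), by rwa [add_comm], by rwa [e₁], hq c hc])
        (by
          have e : (p' ++ (y + x) :: ([] ++ (y + (x + y)) :: q)).sum = (p' ++ [y]).sum + q.sum := by
            simp only [List.sum_append, List.sum_cons, List.sum_nil, add_zero, e₁, List.nil_append,
              ← add_assoc]
            rw [add_assoc _ x x, add_self_eq_zero, add_zero]
          rwa [e])
        ⟨y + x, by simp, y + (x + y), by simp, by rw [e₁, add_comm]; exact hxz.symm⟩)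
    refine ⟨S, by simpa using hS, S', by simpa using hS₂, Conn.trans (S := T) (Conn.symm ?_) ?_⟩
    · simpa using hTS
    · have hw : AllConn (p' ++ (y + x) :: y :: (x + y) :: q) := by
        refine ih _ (by simp) ?_
        rw [add_comm y x]
        exact not_rigid_of_alternating hz hy hyz.symm
      simpa using hw.conn_of_mem hy hx hxy.symm hT hS₁
  by_cases hqy : ∃ q', q = y :: q'
  -- Mirror image: the detour is the class of the last pair in `x, y, x + y, y`, whose contraction
  -- contains `x, y, x`.
  · obtain ⟨q', rfl⟩ := hqy
    obtain ⟨T, hT, S, hS, hTS⟩ := link_of_alternating (p := p ++ [x]) (q := q') hy hz hyz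
      (exists_validFor (by
          simp only [List.mem_append, List.mem_cons, List.not_mem_nil, or_false]
          rintro c ((hc | rfl) | rfl | hc)
          exacts [hp c hc, hx, hz, hq c (by simp [hc])])
        (by
          have e : (p ++ [x] ++ (x + y) :: q').sum = p.sum + (y :: q').sum := by
            simp only [List.sum_append, List.sum_cons, List.sum_nil, add_zero, ← add_assoc]
            rw [add_assoc _ x x, add_self_eq_zero, add_zero]
          rwa [e])
        ⟨x, by simp, x + y, by simp, hxz⟩)
    obtain ⟨T', hT₁, hT₂⟩ := exists_mem_inter (p := p) (m := []) (q := q') hx hy hxy hz hy hyz.symm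
      (exists_validFor (by
          simp only [List.nil_append, List.mem_append, List.mem_cons]
          rintro c (hc | rfl | rfl | hc)
          exacts [hp c hc, hz, by rwa [e₂], hq c (by simp [hc])])
        (by
          have e : (p ++ (x + y) :: ([] ++ (x + y + y) :: q')).sum = p.sum + (y :: q').sum := by
            simp only [List.sum_append, List.sum_cons, List.nil_append, e₂, ← add_assoc]
            rw [add_assoc p.sum x y, add_assoc p.sum, show x + y + x = y by
              clear * -; revert x y; decide]
          rwa [e])
        ⟨x + y, by simp, x + y + y, by simp, by rw [e₂]; exact hxz.symm⟩)
    refine ⟨T', by simpa using hT₁, T, by simpa using hT, Conn.trans (S := S) ?_ (Conn.symm ?_)⟩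
    · have hw : AllConn ((p ++ [x, y]) ++ (x + y + y) :: q') := by
        refine ih _ (by simp) ?_
        rw [e₂]
        simpa using not_rigid_of_alternating (p := p) (q := q') hx hy hxy
      have := hw.conn_of_mem hz hy hyz.symm hT₂ (by simpa using hS)
      simpa using this
    · simpa using hTS
  -- The only obstructions to rigidity are blocks of color `y` adjacent to the triple.
  have hcases : (∃ u, u <:+ p ∧ u.sum = y) ∨ ∃ u, u <+: q ∧ u.sum = y := by
    by_contra! hc
    exact hr (rigid_of_forall_sum_ne hx hy hxy hp hq hc.1 hc.2)
  have hconst : ∀ p q : List Color, (∀ c ∈ p, c ≠ 0) → (∀ c ∈ q, c ≠ 0) → p.sum + q.sum ≠ y →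
      (∃ c ∈ p ++ q, c ≠ y) → ∃ T, ValidFor T (p ++ y :: q) := by
    rintro p q hp hq hpq ⟨c, hc, hcy⟩
    refine exists_validFor ?_ ?_ ⟨c, ?_, y, by simp, hcy⟩
    · simp only [List.mem_append, List.mem_cons]
      rintro c (hc | rfl | hc)
      exacts [hp c hc, hy, hq c hc]
    · rw [List.sum_append, List.sum_cons, add_left_comm]
      exact (add_ne_zero_iff_ne _ _).2 hpq.symm
    · rcases List.mem_append.1 hc with hc | hc <;> simp [hc]
  -- A constant block of sum `y` would consist of letters `y`, but `p` does not end in `y`. So the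
  -- block is not constant and carries a tree.
  have hlast : ∀ u : List Color, u <:+ p → u.sum = y → ∃ T, ValidFor T u := by
    intro u hu hus
    refine exists_validFor (fun c hc => hp c (hu.subset hc)) (by rwa [hus]) ?_
    by_contra! hc
    rcases List.eq_nil_or_concat u with rfl | ⟨u', a, rfl⟩
    · exact hy hus.symm
    rw [List.concat_eq_append] at *
    obtain ⟨t, rfl⟩ := hu
    rcases sum_eq_of_forall_eq (z := a) (fun c h => hc c h a (by simp)) with h | h
    · exact hy (hus.symm.trans h)
    · exact hpy ⟨t ++ u', by rw [← hus, h, List.append_assoc]⟩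
  have hfirst : ∀ u : List Color, u <+: q → u.sum = y → ∃ T, ValidFor T u := by
    intro u hu hus
    refine exists_validFor (fun c hc => hq c (hu.subset hc)) (by rwa [hus]) ?_
    by_contra! hc
    cases u with
    | nil => exact hy hus.symm
    | cons a u' =>
      obtain ⟨t, rfl⟩ := hu
      rcases sum_eq_of_forall_eq (z := a) (fun c h => hc c h a (by simp)) with h | h
      · exact hy (hus.symm.trans h)
      · exact hqy ⟨u' ++ t, by rw [← hus, h]; rfl⟩
  rcases hcases with ⟨u, hu, hus⟩ | ⟨u, hu, hus⟩
  · obtain ⟨L, hL⟩ := hlast u hu hus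
    obtain ⟨p', rfl⟩ := hu
    by_cases hc : ∃ c ∈ p' ++ q, c ≠ y
    · refine link_of_suffix hx hy hxy hL hus (hconst p' q (fun c hc => hp c (by simp [hc])) hq ?_ hc)
      rw [List.sum_append, hus, add_right_comm] at hs'
      exact (add_ne_zero_iff_ne _ _).1 hs'
    · push Not at hc
      -- All letters outside the block equal `y`. Then `q`, which cannot begin with `y`, is empty,
      -- and since the total is nonzero, `p'` has sum zero. All of `p` becomes the block, and the
      -- ambient tree is a single leaf.
      obtain rfl : q = [] := by
        cases q with
        | nil => rfl
        | cons c q => exact absurd ⟨q, by rw [hc c (by simp)]⟩ hqy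
      have hps : (p' ++ u).sum = y := by
        rw [List.sum_nil, add_zero, List.sum_append, hus] at hs'
        rw [List.sum_append, hus]
        rcases sum_eq_of_forall_eq (z := y) (u := p') (fun c h => hc c (by simp [h])) with h | h
        · rw [h, zero_add]
        · rw [h, add_self_eq_zero] at hs'
          exact absurd rfl hs'
      obtain ⟨L, hL⟩ := hlast _ (List.suffix_refl _) hps
      exact link_of_suffix (p := []) hx hy hxy hL hps ⟨.nil, validFor_nil hy⟩
  · obtain ⟨R, hR⟩ := hfirst u hu hus
    obtain ⟨q', rfl⟩ := hu
    by_cases hc : ∃ c ∈ p ++ q', c ≠ y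
    · refine link_of_prefix hx hy hxy hR hus (hconst p q' hp (fun c hc => hq c (by simp [hc])) ?_ hc)
      rw [List.sum_append, hus, add_left_comm] at hs'
      exact ((add_ne_zero_iff_ne _ _).1 hs').symm
    · push Not at hc
      obtain rfl : p = [] := by
        rcases List.eq_nil_or_concat p with rfl | ⟨t, a, rfl⟩
        · rfl
        · exact absurd ⟨t, by rw [hc a (by simp)]; simp⟩ hpy
      have hqs : (u ++ q').sum = y := by
        rw [List.sum_nil, zero_add, List.sum_append, hus] at hs'
        rw [List.sum_append, hus]
        rcases sum_eq_of_forall_eq (z := y) (u := q') (fun c h => hc c (by simp [h])) with h | h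
        · rw [h, add_zero]
        · rw [h, add_self_eq_zero] at hs'
          exact absurd rfl hs'
      obtain ⟨R, hR⟩ := hfirst _ (List.prefix_refl _) hqs
      have := link_of_prefix (p := []) (q := []) hx hy hxy hR hqs ⟨.nil, validFor_nil hy⟩
      simpa using this

/-- The classes of two pairs of neighboring leaves are linked if contracting either pair leaves a
word that is not rigid. -/
theorem exists_link {p q p' q' : List Color} {x y x' y' : Color}
    (ih : ∀ w' : List Color, w'.length < (p ++ x :: y :: q).length → ¬ Rigid w' → AllConn w')
    (h₀ : ∀ c ∈ p ++ x :: y :: q, c ≠ 0) (hs : (p ++ x :: y :: q).sum ≠ 0)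
    (hr : ¬ Rigid (p ++ x :: y :: q)) (e : p ++ x :: y :: q = p' ++ x' :: y' :: q')
    (hxy : x ≠ y) (hxy' : x' ≠ y') (h₁ : ¬ Rigid (p ++ (x + y) :: q))
    (hT : (siblingClass p x y q).Nonempty) (hle : p.length ≤ p'.length) :
    ∃ T ∈ siblingClass p x y q, ∃ S ∈ siblingClass p' x' y' q',
      Conn (p ++ x :: y :: q) T S := by
  have hx : x ≠ 0 := h₀ x (by simp)
  have hy : y ≠ 0 := h₀ y (by simp)
  have hx' : x' ≠ 0 := h₀ x' (by simp [e])
  have hy' : y' ≠ 0 := h₀ y' (by simp [e])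
  have hz : x + y ≠ 0 := (add_ne_zero_iff_ne _ _).2 hxy
  have hz' : x' + y' ≠ 0 := (add_ne_zero_iff_ne _ _).2 hxy'
  obtain ⟨m, rfl⟩ : ∃ m, p' = p ++ m := by
    have := List.prefix_of_prefix_length_le (List.prefix_append p (x :: y :: q))
      (e ▸ List.prefix_append p' (x' :: y' :: q')) hle
    obtain ⟨m, hm⟩ := this
    exact ⟨m, hm.symm⟩
  rw [List.append_assoc] at e
  have e := List.append_cancel_left e
  match m, e with
  | [], e =>
    simp only [List.nil_append, List.cons.injEq] at e
    obtain ⟨rfl, rfl, rfl⟩ := e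
    obtain ⟨T, hT⟩ := hT
    exact ⟨T, hT, T, by simpa using hT, .refl _⟩
  | [a], e =>
    simp only [List.cons_append, List.nil_append, List.cons.injEq] at e
    obtain ⟨rfl, rfl, rfl⟩ := e
    by_cases hxy'' : y' = x
    · subst hxy''
      refine link_of_alternating hx hy hxy ?_
      -- By `exists_validFor`, only a constant word could lack a tree. But then the first
      -- contraction would consist of `y' + y, y'` among letters `y`, which is rigid unless nothing
      -- else remains; in that case a single leaf is a valid tree.
      by_contra hc
      have e : (p ++ y :: q').sum = (p ++ y' :: y :: y' :: q').sum := by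
        simp only [List.sum_append, List.sum_cons]
        rw [add_left_comm y y', ← add_assoc y' y', add_self_eq_zero, zero_add]
      have hconst : ∀ c ∈ p ++ y :: q', c = y := by
        by_contra! hne
        obtain ⟨c, hc', hcy⟩ := hne
        refine hc (exists_validFor ?_ (by rwa [e]) ⟨c, hc', y, by simp, hcy⟩)
        intro c hc
        apply h₀
        simp only [List.mem_append, List.mem_cons] at hc ⊢
        tauto
      refine h₁ (rigid_of_forall_eq hz hx (by simpa using hy) ?_ ?_ ?_)
      · intro c hc
        rw [hconst c (by simp [hc]), show y' + y + y' = y by clear * -; revert y y'; decide]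
      · intro c hc
        rw [hconst c (by simp [hc]), show y' + y + y' = y by clear * -; revert y y'; decide]
      · by_contra! hc'
        obtain ⟨rfl, rfl⟩ := hc'
        exact hc ⟨.nil, validFor_nil hy⟩
    · obtain rfl : y' = x + y :=
        (eq_or_eq_add hx hy hy' hxy hxy'.symm).resolve_left hxy''
      exact link_of_not_rigid ih h₀ hs hxy hr
  | a :: b :: m, e =>
    simp only [List.cons_append, List.cons.injEq] at e
    obtain ⟨rfl, rfl, rfl⟩ := e
    -- If the double contraction had no tree, it would be constant; undoing one merge would then
    -- leave a rigid word, against `h₁`.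
    have hmerge : ∃ T, ValidFor T (p ++ (x + y) :: (m ++ (x' + y') :: q')) := by
      by_contra hc
      have hconst : ∀ c ∈ p ++ (x + y) :: (m ++ (x' + y') :: q'), c = x' + y' := by
        by_contra! hne
        obtain ⟨c, hc', hcy⟩ := hne
        refine hc (exists_validFor ?_ ?_ ⟨c, hc', x' + y', by simp, hcy⟩)
        · intro c hc
          simp only [List.mem_append, List.mem_cons] at hc
          rcases hc with hc | rfl | hc | rfl | hc
          exacts [h₀ c (by simp [hc]), hz, h₀ c (by simp [hc]), hz', h₀ c (by simp [hc])]
        · simpa [add_assoc] using hs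
      have := rigid_of_forall_eq (p := p ++ (x + y) :: m) (q := q') hx' hy' hxy'
        (fun c hc => hconst c (by
          simp only [List.mem_append, List.mem_cons] at hc ⊢
          tauto))
        (fun c hc => hconst c (by simp [hc])) (.inl (by simp))
      exact h₁ (by simpa using this)
    obtain ⟨T, hT₁, hT₂⟩ := exists_mem_inter hx hy hxy hx' hy' hxy' hmerge
    exact ⟨T, hT₁, T, hT₂, .refl _⟩

/-! ### Induction on the number of leaves -/

theorem Reducible.exists_mem {T : Tree} {w : List Color} (h : Reducible T w) :
    ∃ p x y q, w = p ++ x :: y :: q ∧ x ≠ y ∧ ¬ Rigid (p ++ (x + y) :: q) ∧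
      T ∈ siblingClass p x y q := by
  obtain ⟨T₀, w₀, ⟨-, p, x, y, q, rfl, rfl, hxy, rfl⟩, he⟩ := h
  exact ⟨p, x, y, q, rfl, hxy, he.not_rigid, T₀, he.validFor, rfl⟩

/-- All trees valid for a word that is not rigid are connected by rotations between valid trees. -/
theorem allConn_of_not_rigid {w : List Color} (hw : ¬ Rigid w) : AllConn w := by
  induction hn : w.length using Nat.strong_induction_on generalizing w with
  | _ n ih =>
  intro T S hT hS
  -- In the base case the word is `x, y, x`, and its only two trees are joined by a rotation.
  by_cases hlen : w.length ≤ 3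
  · obtain ⟨x, y, hx, hy, hxy, rfl, hT'⟩ := (hT.hasEdge hw).of_length_le_three hlen
    have hst := (step_three hx hy hxy).conn
    rcases hT' with rfl | rfl <;> rcases hS.eq_of_length_eq_three rfl with rfl | rfl
    exacts [.refl _, hst, hst.symm, .refl _]
  -- Both trees are moved to trees whose contraction retains an edge. The contracted words are then
  -- not rigid, so their sibling classes are connected by induction.
  obtain ⟨T₁, hT₁, rT⟩ := (hT.hasEdge hw).exists_reducible (by omega)
  obtain ⟨S₁, hS₁, rS⟩ := (hS.hasEdge hw).exists_reducible (by omega)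
  refine hT₁.trans (Conn.trans ?_ hS₁.symm)
  have h₀ : ∀ c ∈ w, c ≠ 0 := fun c hc => hT.ne_zero_of_mem hc
  have hs := hT.sum_ne_zero
  obtain ⟨p, x, y, q, rfl, hxy, hr, mT⟩ := rT.exists_mem
  obtain ⟨p', x', y', q', e, hxy', hr', mS⟩ := rS.exists_mem
  have ih' : ∀ w' : List Color, w'.length < (p ++ x :: y :: q).length → ¬ Rigid w' → AllConn w' :=
    fun w' hw' hr => ih _ (hn ▸ hw') hr rfl
  have cT : ∀ T' ∈ siblingClass p x y q, Conn (p ++ x :: y :: q) T₁ T' := fun T' hT' =>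
    (ih' _ (by simp) hr).conn_of_mem (h₀ x (by simp)) (h₀ y (by simp)) hxy mT hT'
  have cS : ∀ S' ∈ siblingClass p' x' y' q', Conn (p ++ x :: y :: q) S₁ S' := fun S' hS' => by
    rw [e] at h₀ ih' ⊢
    exact (ih' _ (by simp) hr').conn_of_mem (h₀ x' (by simp)) (h₀ y' (by simp)) hxy' mS hS'
  rcases le_total p.length p'.length with hle | hle
  · obtain ⟨T', hT', S', hS', hc⟩ := exists_link ih' h₀ hs hw e hxy hxy' hr ⟨_, mT⟩ hle
    exact (cT T' hT').trans (hc.trans (cS S' hS').symm)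
  · obtain ⟨S', hS', T', hT', hc⟩ := exists_link (e ▸ ih') (e ▸ h₀) (e ▸ hs) (e ▸ hw) e.symm hxy'
      hxy hr' ⟨_, mS⟩ hle
    rw [← e] at hc
    exact (cT T' hT').trans (hc.symm.trans (cS S' hS').symm)

/-! ### The color graph -/

theorem reachable_of_conn {d : ℕ} {c : Fin (d + 2) → Color} {T S : Tree}
    (h : Conn (List.ofFn c) T S) (hT : T.numLeaves = d + 2) (hS : S.numLeaves = d + 2)
    (vT : Valid T c) (vS : Valid S c) :
    (colorGraph c).Reachable ⟨⟨T, hT⟩, vT⟩ ⟨⟨S, hS⟩, vS⟩ := by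
  -- `EqvGen` is reflexive at every tree, valid or not, so equality is kept as a separate
  -- alternative.
  have key : ∀ {T S : Tree}, Conn (List.ofFn c) T S → T = S ∨
      ∃ (hT : T.numLeaves = d + 2) (hS : S.numLeaves = d + 2) (vT : Valid T c) (vS : Valid S c),
        (colorGraph c).Reachable ⟨⟨T, hT⟩, vT⟩ ⟨⟨S, hS⟩, vS⟩ := by
    intro T S h
    induction h with
    | rel T S h =>
      by_cases hne : T = S
      · exact .inl hne
      have hT : T.numLeaves = d + 2 := by rw [← h.1.length_eq]; simp
      have hS : S.numLeaves = d + 2 := by rw [← h.2.1.length_eq]; simp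
      refine .inr ⟨hT, hS, (valid_iff_validFor _ _).2 h.1, (valid_iff_validFor _ _).2 h.2.1,
        SimpleGraph.Adj.reachable ?_⟩
      simp [colorGraph, associahedron, hne, h.2.2]
    | refl => exact .inl rfl
    | symm T S _ ih =>
      rcases ih with rfl | ⟨a, b, a', b', h⟩
      exacts [.inl rfl, .inr ⟨b, a, b', a', h.symm⟩]
    | trans _ _ _ _ _ ih₁ ih₂ =>
      rcases ih₁ with rfl | ⟨a, b, a', b', h₁⟩
      · exact ih₂
      rcases ih₂ with rfl | ⟨e, f, e', f', h₂⟩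
      · exact .inr ⟨a, b, a', b', h₁⟩
      · exact .inr ⟨a, f, a', f', h₁.trans h₂⟩
  rcases key h with rfl | ⟨_, _, _, _, h'⟩
  exacts [.refl _, h']

end ColoredTree

theorem theorem6p2 (d : ℕ) (c : Fin (d + 2) → ColoredTree.Color)
    (hc : ColoredTree.Acceptable c) :
    (ColoredTree.colorGraph c).Connected ∨ (ColoredTree.colorGraph c).edgeSet = ∅ := by
  by_cases hr : ColoredTree.Rigid (List.ofFn c)
  · right
    rw [SimpleGraph.edgeSet_eq_empty, SimpleGraph.eq_bot_iff_forall_not_adj]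
    rintro ⟨⟨T, hT⟩, vT⟩ ⟨⟨S, hS⟩, vS⟩ h
    simp only [ColoredTree.colorGraph, ColoredTree.associahedron, SimpleGraph.comap_adj,
      SimpleGraph.fromRel_adj, SimpleGraph.induce] at h
    have vT := (ColoredTree.valid_iff_validFor _ _).1 vT
    have vS := (ColoredTree.valid_iff_validFor _ _).1 vS
    refine ColoredTree.HasEdge.not_rigid (T := T) ⟨S, ?_⟩ hr
    rcases h.2 with h | h
    exacts [.inl ⟨vT, vS, h⟩, .inr ⟨vS, vT, h⟩]
  · left
    obtain ⟨T, hT⟩ := hc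
    have hl : T.numLeaves = d + 2 := by
      rw [← ((ColoredTree.valid_iff_validFor _ _).1 hT).length_eq]; simp
    -- Acceptability provides the vertex that `Connected` requires.
    have : Nonempty {T : {T : ColoredTree.Tree // T.numLeaves = d + 2} |
        ColoredTree.Valid T.1 c} := ⟨⟨⟨T, hl⟩, hT⟩⟩
    refine ⟨?_⟩
    rintro ⟨⟨T, hT⟩, vT⟩ ⟨⟨S, hS⟩, vS⟩
    exact ColoredTree.reachable_of_conn (ColoredTree.allConn_of_not_rigid hr T S
      ((ColoredTree.valid_iff_validFor _ _).1 vT) ((ColoredTree.valid_iff_validFor _ _).1 vS))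
      hT hS vT vS
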